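/- **Terrains.** A polygonal terrain is $\mathcal T=\mathcal P_0\setminus(\mathcal P_1\cup\dots\cup\mathcal P_k)$, where $\mathcal P_0$ is a simple polygon (a closed region in the plane) and $\mathcal P_1,\dots,\mathcal P_k$ ($k\ge 0$) are pairwise disjoint simple polygons (the obstacles) contained in the interior of $\mathcal P_0$; the boundaries of all $\mathcal P_i$ are counted as part of $\mathcal T$. Let $P$ be the sum of the perimeters of $\mathcal P_0,\dots,\mathcal P_k$ and let $D$ be the diameter of the convex hull of $\mathcal T$. Points $p,q$ are visible from each other if the segment $pq$ is contained in $\mathcal T$ (unlimited vision). A robot moving along a polygonal line in $\mathcal T$ explores the points of $\mathcal T$ that are visible from some point of its trajectory. **Algorithm.** The robot starts at an arbitrary point $v\in\mathcal T$; it is given none of $\mathcal T,P,D,k$. *Preliminary walk.* The robot chooses an arbitrary half-line $\alpha$ from $v$ and follows it as far as possible within $\mathcal T$. It is then on the boundary of some polygon $\mathcal P$; it traverses this whole boundary, and then goes around $\mathcal P$ to the point $u$ of $\mathcal P\cap\alpha$ farthest from $v$. If it can progress on $\alpha$ from $u$, it does so in the same way. If not, it fixes a smallest axis-parallel square $S$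 containing $\mathcal P$, initialises a quadtree with the single node $S$, and calls ExpTrav$(\mathcal P,u)$. *ExpTrav$(R,r^*)$*, where $r^*$ is on the boundary of $R$ and lies in a terminal square $S_t$ of the current quadtree (in a recursive call, the square $S_t$ used to select $r^*$): 1. traverse the whole boundary of $R$ once, starting and ending at $r^*$; 2. partition $S_t$ into four equal squares, which replace it as terminal squares; 3. traverse the boundary of $R$ once more, starting and ending at $r^*$; at the first position $r$ (the current one included) from which some point $q$ is visible that lies on the boundary of a polygon $Q$ on which ExpTrav has not yet been called and in a terminal square $S_t$ with $|rq|\le 2\,\mathrm{diam}(S_t)$, choose such $q,Q,S_t$ arbitrarily, traverse the segment $rq$, execute ExpTrav$(Q,q)$, traverse the segment $qr$, and resume the traversal from $r$ (testing $r$ again). Squares are closed, and the boundary of each polygon is always traversed in the same direction. **Theorem.** For every polygonal terrain $\mathcal T$, every starting point, every half-line and every way of making the arbitrary choices, the algorithm terminates, its trajectory is contained in $\mathcal T$, every point of $\mathcal T$ is explored, and the trajectory (the preliminary walk included) has length at most $5P+12D\sqrt k$, hence $O(P+D\sqrt k)$. -/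

import Mathlib

noncomputable section

namespace TerrainExploration

/-- The Euclidean plane. -/
abbrev Plane : Type := EuclideanSpace ℝ (Fin 2)

/-! ### Polygonal lines -/

/-- The set of points on the polygonal line through the given points. -/
def polylineTrace : List Plane → Set Plane
  | [] => ∅
  | [p] => {p}
  | p :: q :: l => segment ℝ p q ∪ polylineTrace (q :: l)

/-- The length of the polygonal line through the given points. -/
def polylineLength : List Plane → ℝ
  | [] => 0
  | [_] => 0
  | p :: q :: l => dist p q + polylineLength (q :: l)

/-! ### Simple polygons -/

/-- The boundary of a polygon, run through in the order of its vertices: at time `m + θ` with `m` a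
natural number and `0 ≤ θ < 1` one is at the point dividing the `m`-th edge (indices modulo `n`)
in the ratio `θ : 1 - θ`. Only times `0 ≤ t` are used; one full turn takes time `n`. -/
def loop {n : ℕ} [NeZero n] (Q : Polygon Plane n) (t : ℝ) : Plane :=
  AffineMap.lineMap (Q (Fin.ofNat n ⌊t⌋₊)) (Q (Fin.ofNat n (⌊t⌋₊ + 1))) (t - ⌊t⌋₊)

/-- A simple polygon: its boundary passes through no point twice during one turn. -/
structure SimplePolygon where
  /-- the number of vertices -/
  n : ℕ
  [neZero : NeZero n]
  three_le : 3 ≤ n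
  /-- the vertices -/
  toPolygon : Polygon Plane n
  simple : Set.InjOn (loop toPolygon) (Set.Ico 0 (n : ℝ))

attribute [instance] SimplePolygon.neZero

namespace SimplePolygon

variable (Q : SimplePolygon)

/-- The boundary curve. -/
def bdry : Set Plane := Q.toPolygon.boundary ℝ

/-- The points enclosed by the boundary curve: the bounded part of its complement. -/
def inside : Set Plane :=
  {x | x ∉ Q.bdry ∧ Bornology.IsBounded (connectedComponentIn Q.bdryᶜ x)}

/-- The closed polygonal region. -/
def region : Set Plane := Q.bdry ∪ Q.inside

/-- The perimeter: the sum of the lengths of the edges. -/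
def perimeter : ℝ := ∑ i, dist (Q.toPolygon i) (Q.toPolygon (finRotate Q.n i))

/-- The position on the boundary at time `t`. -/
def pos (t : ℝ) : Plane := loop Q.toPolygon t

/-- The polygonal line that follows the boundary from time `s` to time `t ≥ s`: it starts in the
position at time `s`, passes the vertices reached at the integers strictly between `s` and `t`,
and ends in the position at time `t`. -/
def run (s t : ℝ) : List Plane :=
  Q.pos s :: ((List.range' (⌊s⌋₊ + 1) (⌈t⌉₊ - (⌊s⌋₊ + 1))).map (fun m => Q.pos (m : ℝ))
    ++ [Q.pos t])

end SimplePolygon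

/-! ### Terrains -/

/-- A terrain: a simple polygon `poly none`, in the interior of which lie pairwise disjoint
polygonal obstacles `poly (some i)`, one for each label `i`. -/
structure Terrain (ι : Type*) where
  poly : Option ι → SimplePolygon
  obstacle_subset : ∀ i : ι, (poly (some i)).region ⊆ (poly none).inside
  obstacle_disjoint : ∀ i j : ι, i ≠ j → Disjoint (poly (some i)).region (poly (some j)).region

namespace Terrain

variable {ι : Type*} (T : Terrain ι)

/-- The points of the terrain; the boundaries of all polygons belong to it. -/
def carrier : Set Plane := (T.poly none).region \ ⋃ i : ι, (T.poly (some i)).inside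

/-- The total perimeter, including the perimeters of the obstacles. -/
def perimeter [Fintype ι] : ℝ := ∑ i : Option ι, (T.poly i).perimeter

/-- The diameter of the convex hull. -/
def hullDiam : ℝ := Metric.diam (convexHull ℝ T.carrier)

/-- `q` is seen from `p` (unlimited vision). -/
def Sees (p q : Plane) : Prop := segment ℝ p q ⊆ T.carrier

/-- The points explored by a robot which has visited the points of `A`. -/
def explored (A : Set Plane) : Set Plane := {q | ∃ p ∈ A, T.Sees p q}

end Terrain

/-! ### Squares -/

/-- An axis-parallel square, given by its lower left corner and its side. -/
@[ext] structure Square where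
  x : ℝ
  y : ℝ
  side : ℝ

namespace Square

/-- The (closed) square as a set of points. -/
def carrier (S : Square) : Set Plane :=
  {p | p 0 ∈ Set.Icc S.x (S.x + S.side) ∧ p 1 ∈ Set.Icc S.y (S.y + S.side)}

/-- The diameter. -/
def diam (S : Square) : ℝ := Metric.diam S.carrier

/-- The four squares into which the two symmetry axes divide `S`. -/
def children (S : Square) : Set Square :=
  {⟨S.x, S.y, S.side / 2⟩, ⟨S.x + S.side / 2, S.y, S.side / 2⟩,
   ⟨S.x, S.y + S.side / 2, S.side / 2⟩, ⟨S.x + S.side / 2, S.y + S.side / 2, S.side / 2⟩}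

/-- `S` is a smallest square containing `A`. -/
def IsSmallest (S : Square) (A : Set Plane) : Prop :=
  A ⊆ S.carrier ∧ ∀ S' : Square, A ⊆ S'.carrier → S.side ≤ S'.side

/-- Partition one of the terminal squares into four. -/
def split (leaves : Set Square) (S : Square) : Set Square := (leaves \ {S}) ∪ S.children

end Square

/-! ### The algorithm -/

/-- One active call of the recursive procedure. Times refer to the boundary run `pos` of the
polygon. -/
structure Frame (ι : Type*) where
  /-- the polygon of this call -/
  i : Option ι
  /-- the time of the starting point on its boundary -/
  start : ℝ
  /-- the time up to which the boundary has been traversed in exploration mode -/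
  now : ℝ

/-- The state of the robot. The first component is always the polygonal line travelled so far.
* `walk path τ`: the robot is in the preliminary walk, at the point with parameter `τ` on the
  half-line.
* `explore path leaves known stack`: `leaves` are the terminal squares of the quadtree, `known` is
  the set of polygons on which the recursive procedure has been called, and `stack` lists the
  active calls, the innermost one first. -/
inductive State (ι : Type*)
  | walk (path : List Plane) (τ : ℝ)
  | explore (path : List Plane) (leaves : Set Square) (known : Set (Option ι))
      (stack : List (Frame ι))

namespace State

variable {ι : Type*}

/-- The polygonal line travelled so far. -/
def path : State ι → List Plane
  | walk path _ => path
  | explore path _ _ _ => path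

/-- The outermost call of the procedure has been completed. -/
def Finished : State ι → Prop
  | walk _ _ => False
  | explore _ _ _ stack => stack = []

/-- The robot starts at `v`. -/
def init (v : Plane) : State ι := walk [v] 0

end State

variable {ι : Type*} (T : Terrain ι)

/-- From `r`, the point `q` on the boundary of the new polygon `j` (one on which the procedure has
not yet been called) can be approached: it is visible, it lies in the terminal square `S`, and its
distance is at most twice the diameter of `S`. -/
def Approachable (leaves : Set Square) (known : Set (Option ι)) (r : Plane)
    (S : Square) (j : Option ι) (q : Plane) : Prop :=
  S ∈ leaves ∧ j ∉ known ∧ q ∈ (T.poly j).bdry ∧ q ∈ S.carrier ∧ T.Sees r q ∧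
    dist r q ≤ 2 * S.diam

/-- From `r`, some point of some new polygon can be approached. -/
def SomethingApproachable (leaves : Set Square) (known : Set (Option ι)) (r : Plane) : Prop :=
  ∃ S j q, Approachable T leaves known r S j q

/-- The point with parameter `τ ≥ 0` on the half-line from `v` in direction `d`. -/
def ray (v d : Plane) (τ : ℝ) : Plane := v + τ • d

/-- One round of the preliminary walk. From the point with parameter `τ` on the half-line the robot
follows the half-line as far as possible, which takes it to the point with parameter `τ'`. There it
is on the boundary of polygon `i`, at time `s` of the boundary run. It traverses the entire
boundary, and then goes around to the point of the polygon on the half-line that is farthest from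
`v`; that point has parameter `τu` on the half-line and time `t` on the boundary run. The
resulting path is `path'`. -/
def WalkRound (v d : Plane) (path : List Plane) (τ : ℝ)
    (i : Option ι) (t τu : ℝ) (path' : List Plane) : Prop :=
  ∃ τ' s : ℝ,
    IsGreatest {x | τ ≤ x ∧ T.Sees (ray v d τ) (ray v d x)} τ' ∧
    s ∈ Set.Ico 0 ((T.poly i).n : ℝ) ∧ (T.poly i).pos s = ray v d τ' ∧
    IsGreatest {x | 0 ≤ x ∧ ray v d x ∈ (T.poly i).region} τu ∧
    t ∈ Set.Ico s (s + (T.poly i).n) ∧ (T.poly i).pos t = ray v d τu ∧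
    path' = path ++ (T.poly i).run s (s + (T.poly i).n) ++ (T.poly i).run s t

/-- At the point with parameter `τ`, the robot can progress on the half-line. -/
def CanProgress (v d : Plane) (τ : ℝ) : Prop :=
  ∃ x, τ < x ∧ T.Sees (ray v d τ) (ray v d x)

/-- The steps of the algorithm, for a robot starting at `v` and choosing the half-line from `v` in
direction `d`. All choices that the algorithm leaves open are left open here. -/
inductive Step (v d : Plane) : State ι → State ι → Prop
  /-- A round of the preliminary walk, after which the robot can progress on the half-line. -/
  | progress {path path' : List Plane} {τ τu t : ℝ} {i : Option ι}
      (round : WalkRound T v d path τ i t τu path') (free : CanProgress T v d τu) :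
      Step v d (.walk path τ) (.walk path' τu)
  /-- A round of the preliminary walk, after which the robot cannot progress on the half-line. It
  initializes the quadtree to a smallest square `S` containing the polygon it went around, and
  calls the procedure on that polygon: it traverses the boundary (recognition mode) and
  partitions `S`. -/
  | start {path path' : List Plane} {τ τu t : ℝ} {i : Option ι} {S : Square}
      (round : WalkRound T v d path τ i t τu path') (blocked : ¬ CanProgress T v d τu)
      (smallest : S.IsSmallest (T.poly i).region) :
      Step v d (.walk path τ)
        (.explore (path' ++ (T.poly i).run t (t + (T.poly i).n)) S.children {i} [⟨i, t, t⟩])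
  /-- The robot traverses the boundary of the current polygon `i` in exploration mode until, for the
  first time, something is approachable. It approaches such a point `q` (at time `w` of the boundary
  run of the new polygon `j`) along a segment and calls the procedure on `j`: it traverses the
  boundary of `j` (recognition mode) and partitions the terminal square containing `q`. -/
  | approach {path : List Plane} {leaves : Set Square} {known : Set (Option ι)}
      {i j : Option ι} {s now t w : ℝ} {rest : List (Frame ι)} {S : Square}
      (first : IsLeast {x | x ∈ Set.Icc now (s + (T.poly i).n) ∧
        SomethingApproachable T leaves known ((T.poly i).pos x)} t)
      (hw : w ∈ Set.Ico 0 ((T.poly j).n : ℝ))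
      (app : Approachable T leaves known ((T.poly i).pos t) S j ((T.poly j).pos w)) :
      Step v d (.explore path leaves known (⟨i, s, now⟩ :: rest))
        (.explore (path ++ (T.poly i).run now t ++ (T.poly j).run w (w + (T.poly j).n))
          (Square.split leaves S) (insert j known) (⟨j, w, w⟩ :: ⟨i, s, t⟩ :: rest))
  /-- Nothing becomes approachable on the rest of the boundary of the current polygon `i`, so the
  robot completes its exploration and returns from the call, along the approaching segment, to
  the point of the polygon `i'` from which `i` was approached. -/
  | back {path : List Plane} {leaves : Set Square} {known : Set (Option ι)}
      {i i' : Option ι} {s now s' now' : ℝ} {rest : List (Frame ι)}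
      (nothing : ∀ x ∈ Set.Icc now (s + (T.poly i).n),
        ¬ SomethingApproachable T leaves known ((T.poly i).pos x)) :
      Step v d (.explore path leaves known (⟨i, s, now⟩ :: ⟨i', s', now'⟩ :: rest))
        (.explore (path ++ (T.poly i).run now (s + (T.poly i).n) ++ [(T.poly i').pos now'])
          leaves known (⟨i', s', now'⟩ :: rest))
  /-- The same for the outermost call, which ends the algorithm. -/
  | finish {path : List Plane} {leaves : Set Square} {known : Set (Option ι)}
      {i : Option ι} {s now : ℝ}
      (nothing : ∀ x ∈ Set.Icc now (s + (T.poly i).n),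
        ¬ SomethingApproachable T leaves known ((T.poly i).pos x)) :
      Step v d (.explore path leaves known [⟨i, s, now⟩])
        (.explore (path ++ (T.poly i).run now (s + (T.poly i).n)) leaves known [])

end TerrainExploration

end

/-!
The proof needs no form of the Jordan curve theorem. About a polygon it uses only that its inside is
open, its region is compact and within the closed convex hull of the boundary
(`SimplePolygon.region_subset_closure_convexHull`), and that a connected set missing the boundary
does not pass from the inside to the rest of the plane (`SimplePolygon.subset_inside`).

*The preliminary walk.* Beyond the last point of an obstacle on the half-line there is free space
(`canProgress_of_obstacle`), so the walk can be blocked only at the outer polygon, and the root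
square contains the whole terrain. Beyond the end of a round the half-line misses its polygon, so
each polygon is gone around at most twice (once completely, once partly), and the parts of the
trajectory on the half-line together are no longer than a chord of the outer polygon, hence than its
perimeter.

*Exploration.* As squares only shrink and the set of known polygons only grows, what is not
approachable at some moment never becomes so. Hence at the end nothing is approachable from any
point of a known boundary. If some polygon were unknown, take a nearest pair `p`, `q` of a known and
an unknown boundary point. The open segment `pq` meets no boundary, and it ends on two different
polygons, so it lies in the terrain (`Terrain.sees_of_nearest`). The parent of the terminal square
`S` containing `q` was split when a polygon meeting this parent became known, so that
`dist p q ≤ 2 * S.diam`, and `q` is approachable from `p` (`exists_approachable`): a contradiction.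
So all boundaries have been traversed, and every point of the terrain sees a boundary point
(`exists_sees_bdry`).

*Length.* The procedure takes two turns around each polygon; with the preliminary walk this gives
`5P`. The approaching segments are at most `4 * S.diam = 4 √2 * S.side` there and back, where `S` is
the square that is split. Splitting raises the number of terminal squares by `3` and the sum of
their sides by `S.side`, and leaves the sum of the areas unchanged. So after the root, of side `σ`,
and `k` further squares have been split, the Cauchy-Schwarz inequality bounds the sum of the sides
of the `k` squares by `σ (√(3k + 4) - 2) ≤ σ √(3k)`, and `4 √2 √3 ≤ 12`. To have this as an
invariant, the inequality is used in the form of a potential `∑ (x - μ) ^ 2 / (2 μ) ≥ 0`, over the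
sides `x` of the terminal squares, with a scale `μ` fixed in advance (`squarePotential_split`,
`exists_scale`).

`WalkInv` and `ExploreInv` collect what holds in all reachable states (`Inv.step`); every such state
allows a step unless the outermost call has been completed (`Inv.exists_step`), and `stepBound`
decreases.
-/

namespace TerrainExploration

open Set

/-! ### Polygonal lines -/

theorem polylineTrace_append {l m : List Plane} {p q : Plane} (hl : l.getLast? = some p)
    (hm : m.head? = some q) :
    polylineTrace (l ++ m) = polylineTrace l ∪ segment ℝ p q ∪ polylineTrace m := by
  obtain ⟨m, rfl⟩ := List.head?_eq_some_iff.1 hm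
  induction l with
  | nil => simp at hl
  | cons a l ih =>
    cases l with
    | nil =>
      obtain rfl : a = p := by simpa using hl
      have : a ∈ segment ℝ a q := left_mem_segment ℝ a q
      simp only [List.cons_append, List.nil_append, polylineTrace]
      rw [singleton_union, insert_eq_of_mem this]
    | cons b l =>
      have := ih (by simpa using hl)
      simp only [List.cons_append, polylineTrace] at this ⊢
      rw [this]
      simp only [union_assoc]

theorem polylineLength_append {l m : List Plane} {p q : Plane} (hl : l.getLast? = some p)
    (hm : m.head? = some q) :
    polylineLength (l ++ m) = polylineLength l + dist p q + polylineLength m := by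
  obtain ⟨m, rfl⟩ := List.head?_eq_some_iff.1 hm
  induction l with
  | nil => simp at hl
  | cons a l ih =>
    cases l with
    | nil =>
      obtain rfl : a = p := by simpa using hl
      simp [polylineLength]
    | cons b l =>
      have := ih (by simpa using hl)
      simp only [List.cons_append, polylineLength] at this ⊢
      rw [this]
      ring

namespace SimplePolygon

variable (Q : SimplePolygon)

/-! ### The boundary run -/

/-- The length of the boundary run from time `0` to time `t ≥ 0`. -/
noncomputable def arc (t : ℝ) : ℝ :=
  ∑ m ∈ Finset.range ⌊t⌋₊, dist (Q.pos m) (Q.pos (m + 1)) +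
    (t - ⌊t⌋₊) * dist (Q.pos ⌊t⌋₊) (Q.pos (⌊t⌋₊ + 1))

theorem pos_natCast (m : ℕ) : Q.pos m = Q.toPolygon (Fin.ofNat Q.n m) := by
  simp [pos, loop]

theorem pos_natCast_succ (m : ℕ) : Q.pos (m + 1) = Q.toPolygon (Fin.ofNat Q.n (m + 1)) := by
  exact_mod_cast Q.pos_natCast (m + 1)

theorem pos_eq_lineMap {m : ℕ} {t : ℝ} (ht : t ∈ Icc (m : ℝ) (m + 1)) :
    Q.pos t = AffineMap.lineMap (Q.pos m) (Q.pos (m + 1)) (t - m) := by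
  rcases ht.2.lt_or_eq with h | h
  · have hf : ⌊t⌋₊ = m := (Nat.floor_eq_iff (m.cast_nonneg.trans ht.1)).2 ⟨ht.1, h⟩
    rw [pos_natCast, pos_natCast_succ, pos, loop, hf]
  · rw [h]; simp

theorem arc_eq_add {m : ℕ} {t : ℝ} (ht : t ∈ Icc (m : ℝ) (m + 1)) :
    Q.arc t = Q.arc m + (t - m) * dist (Q.pos m) (Q.pos (m + 1)) := by
  rcases ht.2.lt_or_eq with h | h
  · have hf : ⌊t⌋₊ = m := (Nat.floor_eq_iff (m.cast_nonneg.trans ht.1)).2 ⟨ht.1, h⟩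
    simp [arc, hf]
  · have hf : ⌊t⌋₊ = m + 1 := by rw [h]; exact_mod_cast Nat.floor_natCast (m + 1)
    simp only [arc, hf, Nat.floor_natCast, Finset.sum_range_succ]
    rw [h]; push_cast; ring

theorem segment_pos {m : ℕ} {s t : ℝ} (hs : (m : ℝ) ≤ s) (hst : s ≤ t) (ht : t ≤ m + 1) :
    segment ℝ (Q.pos s) (Q.pos t) = Q.pos '' Icc s t := by
  have h : Q.pos '' Icc s t =
      AffineMap.lineMap (k := ℝ) (Q.pos m) (Q.pos (m + 1)) '' Icc (s - m) (t - m) := by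
    rw [← image_sub_const_Icc, image_image]
    exact image_congr fun x hx => Q.pos_eq_lineMap ⟨hs.trans hx.1, hx.2.trans ht⟩
  rw [h, Q.pos_eq_lineMap ⟨hs, hst.trans ht⟩, Q.pos_eq_lineMap ⟨hs.trans hst, ht⟩,
    ← segment_eq_Icc (by linarith), image_segment]

theorem dist_pos {m : ℕ} {s t : ℝ} (hs : (m : ℝ) ≤ s) (hst : s ≤ t) (ht : t ≤ m + 1) :
    dist (Q.pos s) (Q.pos t) = Q.arc t - Q.arc s := by
  rw [Q.pos_eq_lineMap ⟨hs, hst.trans ht⟩, Q.pos_eq_lineMap ⟨hs.trans hst, ht⟩,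
    Q.arc_eq_add ⟨hs, hst.trans ht⟩, Q.arc_eq_add ⟨hs.trans hst, ht⟩, dist_lineMap_lineMap,
    Real.dist_eq, abs_sub_comm, abs_of_nonneg (by linarith)]
  ring

theorem run_eq (s t : ℝ) : Q.run s t = Q.pos s ::
    ((List.range' (⌊s⌋₊ + 1) (⌈t⌉₊ - (⌊s⌋₊ + 1))).map (fun m : ℕ => Q.pos m) ++ [Q.pos t]) := by
  simp only [run, List.pure_def, List.bind_eq_flatMap, List.map_flatMap, List.map_cons,
    List.map_nil]
  rw [List.map_eq_flatMap]

theorem head?_run (s t : ℝ) : (Q.run s t).head? = some (Q.pos s) := rfl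

theorem getLast?_run (s t : ℝ) : (Q.run s t).getLast? = some (Q.pos t) := by
  rw [run_eq, ← List.cons_append, List.getLast?_append]; simp

theorem run_of_le {s t : ℝ} (ht : t ≤ ⌊s⌋₊ + 1) :
    Q.run s t = [Q.pos s, Q.pos t] := by
  have : ⌈t⌉₊ ≤ ⌊s⌋₊ + 1 := Nat.ceil_le.2 (by exact_mod_cast ht)
  simp [run_eq, Nat.sub_eq_zero_of_le this]

theorem run_of_lt {s t : ℝ} (ht : (⌊s⌋₊ : ℝ) + 1 < t) :
    Q.run s t = Q.pos s :: Q.run ((⌊s⌋₊ + 1 : ℕ) : ℝ) t := by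
  have h : ⌊s⌋₊ + 1 < ⌈t⌉₊ := Nat.lt_ceil.2 (by exact_mod_cast ht)
  obtain ⟨j, hj⟩ := Nat.exists_eq_add_of_lt h
  have h1 : ⌈t⌉₊ - (⌊s⌋₊ + 1) = j + 1 := by omega
  have h2 : ⌈t⌉₊ - (⌊s⌋₊ + 1 + 1) = j := by omega
  simp only [run_eq, Nat.floor_natCast, h1, h2, List.range'_succ, List.map_cons, List.cons_append]

theorem run_trace_length {s t : ℝ} (hs : 0 ≤ s) (hst : s ≤ t) :
    polylineTrace (Q.run s t) = Q.pos '' Icc s t ∧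
      polylineLength (Q.run s t) = Q.arc t - Q.arc s := by
  induction hk : ⌈t⌉₊ - ⌊s⌋₊ using Nat.strong_induction_on generalizing s with
  | _ k ih =>
    have hfl : (⌊s⌋₊ : ℝ) ≤ s := Nat.floor_le hs
    have hlt : s ≤ ⌊s⌋₊ + 1 := (Nat.lt_floor_add_one s).le
    rcases le_or_gt t (⌊s⌋₊ + 1) with h | h
    · rw [Q.run_of_le h]
      simp only [polylineTrace, polylineLength, add_zero]
      refine ⟨?_, Q.dist_pos hfl hst h⟩
      rw [Q.segment_pos hfl hst h, union_eq_left, singleton_subset_iff]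
      exact mem_image_of_mem _ ⟨hst, le_rfl⟩
    · have hc : ⌊s⌋₊ + 1 < ⌈t⌉₊ := Nat.lt_ceil.2 (by exact_mod_cast h)
      obtain ⟨h1, h2⟩ := ih (⌈t⌉₊ - (⌊s⌋₊ + 1)) (by omega) (s := ((⌊s⌋₊ + 1 : ℕ) : ℝ))
        (by positivity) (by push_cast; exact h.le) (by rw [Nat.floor_natCast])
      rw [Q.run_of_lt h]
      have e : Q.pos s :: Q.run ((⌊s⌋₊ + 1 : ℕ) : ℝ) t
          = [Q.pos s] ++ Q.run ((⌊s⌋₊ + 1 : ℕ) : ℝ) t := rfl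
      rw [e, polylineTrace_append (p := Q.pos s) (by simp) (Q.head?_run _ _),
        polylineLength_append (p := Q.pos s) (by simp) (Q.head?_run _ _), h1, h2]
      push_cast
      rw [Q.segment_pos hfl hlt le_rfl, Q.dist_pos hfl hlt le_rfl]
      simp only [polylineTrace, polylineLength]
      refine ⟨?_, by ring⟩
      rw [singleton_union, insert_eq_of_mem (mem_image_of_mem _ (left_mem_Icc.2 hlt)),
        ← image_union, Icc_union_Icc_eq_Icc hlt h.le]

theorem polylineTrace_run {s t : ℝ} (hs : 0 ≤ s) (hst : s ≤ t) :
    polylineTrace (Q.run s t) = Q.pos '' Icc s t := (Q.run_trace_length hs hst).1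

theorem polylineLength_run {s t : ℝ} (hs : 0 ≤ s) (hst : s ≤ t) :
    polylineLength (Q.run s t) = Q.arc t - Q.arc s := (Q.run_trace_length hs hst).2

end SimplePolygon

theorem polylineLength_nonneg : ∀ l : List Plane, 0 ≤ polylineLength l
  | [] => le_rfl
  | [_] => le_rfl
  | _ :: q :: l => add_nonneg dist_nonneg (polylineLength_nonneg (q :: l))

theorem dist_le_polylineLength {l : List Plane} {p q : Plane} (hp : l.head? = some p)
    (hq : l.getLast? = some q) : dist p q ≤ polylineLength l := by
  induction l generalizing p with
  | nil => simp at hp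
  | cons a l ih =>
    obtain rfl : a = p := by simpa using hp
    cases l with
    | nil =>
      obtain rfl : a = q := by simpa using hq
      simp [polylineLength]
    | cons b l =>
      have := ih (p := b) rfl (by simpa using hq)
      simp only [polylineLength]
      linarith [dist_triangle a b q]

namespace SimplePolygon

variable (Q : SimplePolygon)

theorem dist_pos_le {s t : ℝ} (hs : 0 ≤ s) (hst : s ≤ t) :
    dist (Q.pos s) (Q.pos t) ≤ Q.arc t - Q.arc s := by
  rw [← Q.polylineLength_run hs hst]
  exact dist_le_polylineLength (Q.head?_run s t) (Q.getLast?_run s t)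

theorem arc_mono {s t : ℝ} (hs : 0 ≤ s) (hst : s ≤ t) : Q.arc s ≤ Q.arc t :=
  sub_nonneg.1 (dist_nonneg.trans (Q.dist_pos_le hs hst))

theorem ofNat_add_n (m : ℕ) : Fin.ofNat Q.n (m + Q.n) = Fin.ofNat Q.n m := by
  ext; simp [Fin.ofNat]

theorem pos_add_n {t : ℝ} (ht : 0 ≤ t) : Q.pos (t + Q.n) = Q.pos t := by
  simp only [pos, loop, Nat.floor_add_natCast ht, Nat.cast_add]
  rw [add_right_comm _ Q.n 1, ofNat_add_n, ofNat_add_n, add_sub_add_right_eq_sub]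

theorem finRotate_eq (i : Fin Q.n) : finRotate Q.n i = Fin.ofNat Q.n (i + 1) := by
  rw [finRotate_apply]
  ext
  simp [Fin.ofNat, Fin.val_add]

theorem edge_eq (i : Fin Q.n) :
    Q.toPolygon i = Q.pos (i : ℕ) ∧ Q.toPolygon (finRotate Q.n i) = Q.pos ((i : ℕ) + 1) := by
  rw [pos_natCast, pos_natCast_succ, finRotate_eq]
  simp

theorem perimeter_eq :
    Q.perimeter = ∑ m ∈ Finset.range Q.n, dist (Q.pos m) (Q.pos (m + 1)) := by
  rw [perimeter, Finset.sum_range]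
  exact Finset.sum_congr rfl fun i _ => by rw [(Q.edge_eq i).1, (Q.edge_eq i).2]

theorem arc_add_n {t : ℝ} (ht : 0 ≤ t) : Q.arc (t + Q.n) = Q.arc t + Q.perimeter := by
  have h : ∀ m : ℕ, Q.pos ((m + Q.n : ℕ) : ℝ) = Q.pos m ∧
      Q.pos ((m + Q.n : ℕ) + 1 : ℝ) = Q.pos (m + 1) := fun m => by
    rw [pos_natCast, pos_natCast, pos_natCast_succ, pos_natCast_succ, ofNat_add_n,
      add_right_comm, ofNat_add_n]
    exact ⟨rfl, rfl⟩
  simp only [arc, Nat.floor_add_natCast ht, (h _).1, (h _).2, perimeter_eq]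
  rw [add_comm ⌊t⌋₊ Q.n, Finset.sum_range_add]
  simp only [add_comm Q.n, (h _).1, (h _).2]
  push_cast
  ring

theorem perimeter_nonneg : 0 ≤ Q.perimeter := Finset.sum_nonneg fun _ _ => dist_nonneg

theorem n_pos : (0 : ℝ) < Q.n := by exact_mod_cast Nat.pos_of_ne_zero (NeZero.ne Q.n)

theorem bdry_eq_image_Icc : Q.bdry = Q.pos '' Icc 0 Q.n := by
  have hseg : ∀ i : Fin Q.n,
      Q.toPolygon.edgeSet ℝ i = Q.pos '' Icc ((i : ℕ) : ℝ) ((i : ℕ) + 1) := by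
    intro i
    rw [← Q.segment_pos le_rfl (by linarith) le_rfl, ← (Q.edge_eq i).1, ← (Q.edge_eq i).2,
      ← affineSegment_eq_segment]
    rfl
  simp only [bdry, Polygon.boundary, hseg]
  ext x
  simp only [mem_iUnion, mem_image]
  constructor
  · rintro ⟨i, t, ht, rfl⟩
    have : ((i : ℕ) : ℝ) + 1 ≤ Q.n := by exact_mod_cast i.2
    exact ⟨t, ⟨(Nat.cast_nonneg _).trans ht.1, ht.2.trans this⟩, rfl⟩
  · rintro ⟨t, ht, rfl⟩
    rcases ht.2.lt_or_eq with h | h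
    · have hf : ⌊t⌋₊ < Q.n := (Nat.floor_lt ht.1).2 h
      exact ⟨⟨⌊t⌋₊, hf⟩, t, ⟨Nat.floor_le ht.1, (Nat.lt_floor_add_one t).le⟩, rfl⟩
    · refine ⟨⟨0, Nat.pos_of_ne_zero (NeZero.ne Q.n)⟩, 0, ⟨by simp, by simp⟩, ?_⟩
      rw [h, ← Q.pos_add_n le_rfl, zero_add]

theorem exists_pos_eq {p : Plane} (hp : p ∈ Q.bdry) : ∃ t ∈ Ico 0 (Q.n : ℝ), Q.pos t = p := by
  rw [bdry_eq_image_Icc] at hp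
  obtain ⟨t, ht, rfl⟩ := hp
  rcases ht.2.lt_or_eq with h | h
  · exact ⟨t, ⟨ht.1, h⟩, rfl⟩
  · exact ⟨0, ⟨le_rfl, Q.n_pos⟩, by rw [h, ← Q.pos_add_n le_rfl, zero_add]⟩

theorem pos_mem_bdry {t : ℝ} (ht : 0 ≤ t) : Q.pos t ∈ Q.bdry := by
  have key : ∀ (k : ℕ) (t : ℝ), 0 ≤ t → t ≤ k * Q.n → Q.pos t ∈ Q.bdry := by
    intro k
    induction k with
    | zero =>
      intro t h0 h1
      rw [bdry_eq_image_Icc]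
      exact mem_image_of_mem _ ⟨h0, by simp at h1; linarith [Q.n_pos]⟩
    | succ k ih =>
      intro t h0 h1
      rcases le_or_gt t Q.n with h | h
      · rw [bdry_eq_image_Icc]
        exact mem_image_of_mem _ ⟨h0, h⟩
      · have := ih (t - Q.n) (by linarith) (by push_cast at h1; linarith)
        rwa [← Q.pos_add_n (by linarith), sub_add_cancel] at this
  obtain ⟨k, hk⟩ := exists_nat_ge t
  have : (1 : ℝ) ≤ Q.n := by exact_mod_cast Nat.pos_of_ne_zero (NeZero.ne Q.n)
  exact key k t ht (hk.trans (le_mul_of_one_le_right k.cast_nonneg this))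

theorem exists_pos_eq_of_mem_bdry {p : Plane} (hp : p ∈ Q.bdry) {s : ℝ}
    (hs : s ∈ Ico 0 (Q.n : ℝ)) : ∃ t ∈ Ico s (s + Q.n), Q.pos t = p := by
  obtain ⟨t, ht, rfl⟩ := Q.exists_pos_eq hp
  rcases le_or_gt s t with h | h
  · exact ⟨t, ⟨h, by linarith [ht.2, hs.1]⟩, rfl⟩
  · exact ⟨t + Q.n, ⟨by linarith [ht.1, hs.2], by linarith⟩, Q.pos_add_n ht.1⟩

/-- One full turn, from wherever it starts, covers the boundary. -/
theorem image_pos_turn {s : ℝ} (hs : 0 ≤ s) : Q.pos '' Icc s (s + Q.n) = Q.bdry := by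
  apply subset_antisymm
  · rintro _ ⟨t, ht, rfl⟩
    exact Q.pos_mem_bdry (hs.trans ht.1)
  · intro p hp
    have key : ∀ (k : ℕ) (s : ℝ), 0 ≤ s → s < k * Q.n → p ∈ Q.pos '' Icc s (s + Q.n) := by
      intro k
      induction k with
      | zero => intro s h0 h1; simp at h1; linarith
      | succ k ih =>
        intro s h0 h1
        rcases lt_or_ge s Q.n with h | h
        · obtain ⟨t, ht, rfl⟩ := Q.exists_pos_eq_of_mem_bdry hp ⟨h0, h⟩
          exact mem_image_of_mem _ ⟨ht.1, ht.2.le⟩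
        · obtain ⟨t, ht, rfl⟩ := ih (s - Q.n) (by linarith) (by push_cast at h1; linarith)
          refine ⟨t + Q.n, ⟨by linarith [ht.1], by linarith [ht.2]⟩, Q.pos_add_n ?_⟩
          linarith [ht.1]
    obtain ⟨k, hk⟩ := exists_nat_gt s
    have : (1 : ℝ) ≤ Q.n := by exact_mod_cast Nat.pos_of_ne_zero (NeZero.ne Q.n)
    exact key k s hs (hk.trans_le (le_mul_of_one_le_right k.cast_nonneg this))

theorem continuousOn_pos : ContinuousOn Q.pos (Ici 0) := by
  have hedge : ∀ m : ℕ, ContinuousOn Q.pos (Icc (m : ℝ) (m + 1)) := fun m =>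
    ContinuousOn.congr (f := fun t : ℝ => AffineMap.lineMap (Q.pos m) (Q.pos (m + 1)) (t - m))
      (by
        simp only [AffineMap.lineMap_apply]
        fun_prop) fun t ht => Q.pos_eq_lineMap ht
  have hN : ∀ N : ℕ, ContinuousOn Q.pos (Icc 0 (N : ℝ)) := by
    intro N
    induction N with
    | zero => simp
    | succ N ih =>
      have := ih.union_of_isClosed (hedge N) isClosed_Icc isClosed_Icc
      rw [Icc_union_Icc_eq_Icc N.cast_nonneg (by linarith)] at this
      exact_mod_cast this
  intro t ht
  obtain ⟨N, hN'⟩ := exists_nat_gt t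
  refine (hN N t ⟨ht, hN'.le⟩).mono_of_mem_nhdsWithin ?_
  rw [← Ici_inter_Iic]
  exact Filter.inter_mem self_mem_nhdsWithin (mem_nhdsWithin_of_mem_nhds (Iic_mem_nhds hN'))

theorem isCompact_bdry : IsCompact Q.bdry := by
  rw [bdry_eq_image_Icc]
  exact isCompact_Icc.image_of_continuousOn (Q.continuousOn_pos.mono fun _ h => h.1)

theorem bdry_nonempty : Q.bdry.Nonempty := ⟨_, Q.pos_mem_bdry le_rfl⟩

theorem bdry_nontrivial : Q.bdry.Nontrivial := by
  have h3 : (3 : ℝ) ≤ Q.n := by exact_mod_cast Q.three_le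
  refine ⟨_, Q.pos_mem_bdry le_rfl, _, Q.pos_mem_bdry zero_le_one, fun h => ?_⟩
  exact zero_ne_one (Q.simple (⟨le_rfl, by linarith⟩ : (0 : ℝ) ∈ Ico 0 (Q.n : ℝ))
    (⟨by norm_num, by linarith⟩ : (1 : ℝ) ∈ Ico 0 (Q.n : ℝ)) h)

theorem diam_bdry_le : Metric.diam Q.bdry ≤ Q.perimeter := by
  refine Metric.diam_le_of_forall_dist_le Q.perimeter_nonneg ?_
  have h0 : Q.arc Q.n = Q.arc 0 + Q.perimeter := by simpa using Q.arc_add_n le_rfl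
  have key : ∀ s t : ℝ, 0 ≤ s → s ≤ t → t ≤ Q.n → dist (Q.pos s) (Q.pos t) ≤ Q.perimeter := by
    intro s t hs hst ht
    linarith [Q.dist_pos_le hs hst, Q.arc_mono le_rfl hs, Q.arc_mono (hs.trans hst) ht]
  intro p hp q hq
  obtain ⟨s, hs, rfl⟩ := Q.exists_pos_eq hp
  obtain ⟨t, ht, rfl⟩ := Q.exists_pos_eq hq
  rcases le_total s t with h | h
  · exact key s t hs.1 h ht.2.le
  · rw [dist_comm]; exact key t s ht.1 h hs.2.le

end SimplePolygon

namespace SimplePolygon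

variable (Q : SimplePolygon)

/-! ### Polygonal regions -/

theorem isOpen_bdry_compl : IsOpen Q.bdryᶜ := Q.isCompact_bdry.isClosed.isOpen_compl

/-- A connected set that misses the boundary and meets the inside lies inside. -/
theorem subset_inside {C : Set Plane} (hC : IsPreconnected C) (hd : Disjoint C Q.bdry)
    {x : Plane} (hx : x ∈ C) (hi : x ∈ Q.inside) : C ⊆ Q.inside := by
  have hsub : C ⊆ connectedComponentIn Q.bdryᶜ x :=
    hC.subset_connectedComponentIn hx (subset_compl_iff_disjoint_right.2 hd)
  intro y hy
  refine ⟨fun h => disjoint_left.1 hd hy h, ?_⟩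
  rw [← connectedComponentIn_eq (hsub hy)]
  exact hi.2

theorem isOpen_inside : IsOpen Q.inside := by
  rw [isOpen_iff_mem_nhds]
  intro x hx
  exact Filter.mem_of_superset
    (Q.isOpen_bdry_compl.connectedComponentIn.mem_nhds (mem_connectedComponentIn hx.1))
    (Q.subset_inside isPreconnected_connectedComponentIn
      (subset_compl_iff_disjoint_right.1 (connectedComponentIn_subset _ _))
      (mem_connectedComponentIn hx.1) hx)

theorem isClosed_region : IsClosed Q.region := by
  rw [← isOpen_compl_iff, isOpen_iff_mem_nhds]
  intro x hx
  have hb : x ∉ Q.bdry := fun h => hx (Or.inl h)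
  have hdis := subset_compl_iff_disjoint_right.1 (connectedComponentIn_subset Q.bdryᶜ x)
  refine Filter.mem_of_superset
    (Q.isOpen_bdry_compl.connectedComponentIn.mem_nhds (mem_connectedComponentIn hb)) ?_
  rintro y hy (h | h)
  · exact disjoint_left.1 hdis hy h
  · exact hx (Or.inr (Q.subset_inside isPreconnected_connectedComponentIn hdis hy h
      (mem_connectedComponentIn hb)))

/-- A point outside the convex hull of the boundary is separated from it by a line, so a half-line
from that point escapes to infinity without meeting the boundary. -/
theorem region_subset_closure_convexHull : Q.region ⊆ closure (convexHull ℝ Q.bdry) := by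
  have hsub : Q.bdry ⊆ closure (convexHull ℝ Q.bdry) :=
    (subset_convexHull ℝ _).trans subset_closure
  rintro x (hx | hx)
  · exact hsub hx
  by_contra hn
  obtain ⟨f, u, hu, hxu⟩ := geometric_hahn_banach_closed_point
    (convex_convexHull ℝ Q.bdry).closure isClosed_closure hn
  obtain ⟨p, hp⟩ := Q.bdry_nonempty
  set e := x - p
  have hfe : 0 < f e := by
    have := hu p (hsub hp)
    simp only [e, map_sub]; linarith
  set C := (fun a : ℝ => x + a • e) '' Ici 0
  have hC : IsPreconnected C := isPreconnected_Ici.image _ (by fun_prop)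
  have hd : Disjoint C Q.bdry := by
    rw [disjoint_left]
    rintro _ ⟨a, ha, rfl⟩ hb
    have := hu _ (hsub hb)
    simp only [map_add, map_smul, smul_eq_mul] at this
    nlinarith [mul_nonneg (show (0 : ℝ) ≤ a from ha) hfe.le]
  have hbd : Bornology.IsBounded C := by
    refine hx.2.subset (hC.subset_connectedComponentIn ⟨0, by simp, by simp⟩
      (subset_compl_iff_disjoint_right.2 hd))
  have he : 0 < ‖e‖ := norm_pos_iff.2 fun h => by rw [h, map_zero] at hfe; exact lt_irrefl _ hfe
  obtain ⟨R, hR⟩ := hbd.exists_norm_le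
  have h1 := hR (x + ((|R| + ‖x‖ + 1) / ‖e‖) • e) ⟨_, by simp only [mem_Ici]; positivity, rfl⟩
  have h2 := norm_sub_le (x + ((|R| + ‖x‖ + 1) / ‖e‖) • e) x
  rw [add_sub_cancel_left, norm_smul, Real.norm_of_nonneg (by positivity),
    div_mul_cancel₀ _ he.ne'] at h2
  linarith [le_abs_self R]

theorem isCompact_region : IsCompact Q.region :=
  Metric.isCompact_of_isClosed_isBounded Q.isClosed_region
    ((isBounded_convexHull.2 Q.isCompact_bdry.isBounded).closure.subset
      Q.region_subset_closure_convexHull)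

theorem dist_le_perimeter {p q : Plane} (hp : p ∈ Q.region) (hq : q ∈ Q.region) :
    dist p q ≤ Q.perimeter := by
  refine le_trans ?_ Q.diam_bdry_le
  rw [← convexHull_diam, ← Metric.diam_closure]
  exact Metric.dist_le_diam_of_mem (isBounded_convexHull.2 Q.isCompact_bdry.isBounded).closure
    (Q.region_subset_closure_convexHull hp) (Q.region_subset_closure_convexHull hq)

end SimplePolygon

namespace Terrain

variable {ι : Type*} (T : Terrain ι)

/-! ### Terrains and visibility -/

theorem notMem_bdry_of_mem_region {i : ι} {j : Option ι} (h : some i ≠ j) {p : Plane}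
    (hp : p ∈ (T.poly (some i)).region) : p ∉ (T.poly j).bdry := by
  intro hj
  cases j with
  | none => exact (T.obstacle_subset i hp).1 hj
  | some j =>
    exact disjoint_left.1 (T.obstacle_disjoint i j fun e => h (congrArg some e)) hp (Or.inl hj)

theorem bdry_injective {i j : Option ι} {p : Plane} (hi : p ∈ (T.poly i).bdry)
    (hj : p ∈ (T.poly j).bdry) : i = j := by
  by_contra h
  cases i with
  | some i => exact T.notMem_bdry_of_mem_region h (Or.inl hi) hj
  | none =>
    cases j with
    | none => exact h rfl
    | some j => exact T.notMem_bdry_of_mem_region (Ne.symm h) (Or.inl hj) hi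

theorem bdry_subset_carrier (i : Option ι) : (T.poly i).bdry ⊆ T.carrier := by
  intro p hp
  refine ⟨?_, ?_⟩
  · cases i with
    | none => exact Or.inl hp
    | some i => exact Or.inr (T.obstacle_subset i (Or.inl hp))
  · rw [mem_iUnion]
    rintro ⟨j, hj⟩
    by_cases h : some j = i
    · subst h; exact hj.1 hp
    · exact T.notMem_bdry_of_mem_region h (Or.inr hj) hp

theorem carrier_subset_region : T.carrier ⊆ (T.poly none).region := fun _ h => h.1

theorem isClosed_carrier : IsClosed T.carrier :=
  (T.poly none).isClosed_region.sdiff (isOpen_iUnion fun i => (T.poly (some i)).isOpen_inside)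

theorem isCompact_carrier : IsCompact T.carrier :=
  (T.poly none).isCompact_region.of_isClosed_subset T.isClosed_carrier T.carrier_subset_region

theorem dist_le_hullDiam {p q : Plane} (hp : p ∈ T.carrier) (hq : q ∈ T.carrier) :
    dist p q ≤ T.hullDiam :=
  Metric.dist_le_diam_of_mem (isBounded_convexHull.2 T.isCompact_carrier.isBounded)
    (subset_convexHull ℝ _ hp) (subset_convexHull ℝ _ hq)

/-- A point inside the outer polygon that is in the region of no obstacle, except perhaps of those
in `s`, has a neighbourhood all of whose points outside these regions belong to the terrain. -/
theorem exists_nhds_mem_carrier [Finite ι] {p : Plane} (hp : p ∈ (T.poly none).inside)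
    (s : Set ι) (hs : ∀ i ∉ s, p ∉ (T.poly (some i)).region) :
    ∃ U ∈ nhds p, ∀ x ∈ U, (∀ i ∈ s, x ∉ (T.poly (some i)).region) → x ∈ T.carrier := by
  refine ⟨(T.poly none).inside ∩ ⋂ i ∈ sᶜ, (T.poly (some i)).regionᶜ, ?_, ?_⟩
  · refine Filter.inter_mem ((T.poly none).isOpen_inside.mem_nhds hp) ?_
    rw [Filter.biInter_mem (Set.toFinite _)]
    exact fun i hi => (T.poly (some i)).isClosed_region.isOpen_compl.mem_nhds (hs i hi)
  · rintro x ⟨hx, hx'⟩ hxs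
    refine ⟨Or.inr hx, ?_⟩
    rw [mem_iUnion]
    rintro ⟨i, hi⟩
    by_cases his : i ∈ s
    · exact hxs i his (Or.inr hi)
    · exact (mem_iInter₂.1 hx' i his) (Or.inr hi)

theorem mem_nhds_carrier [Finite ι] {p : Plane} (hp : p ∈ T.carrier)
    (hb : ∀ i, p ∉ (T.poly i).bdry) : T.carrier ∈ nhds p := by
  obtain ⟨U, hU, h⟩ := T.exists_nhds_mem_carrier (hp.1.resolve_left (hb none)) ∅
    (fun i _ h => h.elim (hb _) fun h => hp.2 (mem_iUnion.2 ⟨i, h⟩))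
  exact Filter.mem_of_superset hU fun x hx => h x hx (by simp)

theorem sees_comm {p q : Plane} : T.Sees p q ↔ T.Sees q p := by
  rw [Sees, Sees, segment_symm]

theorem sees_refl {p : Plane} (hp : p ∈ T.carrier) : T.Sees p p := by
  simpa [Sees] using hp

theorem isClosed_sees : IsClosed {z : Plane × Plane | T.Sees z.1 z.2} := by
  have : {z : Plane × Plane | T.Sees z.1 z.2} =
      ⋂ a ∈ Icc (0 : ℝ) 1, {z : Plane × Plane | z.1 + a • (z.2 - z.1) ∈ T.carrier} := by
    ext z
    simp only [Sees, segment_eq_image', image_subset_iff, mem_iInter, mem_ofPred_eq]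
    rfl
  rw [this]
  exact isClosed_biInter fun a _ => T.isClosed_carrier.preimage (by fun_prop)

/-- A connected set of points on no boundary that has, in its closure, points of the boundaries of
two different polygons, lies in the terrain: it cannot lie inside an obstacle, nor outside the outer
polygon, as its closure meets another boundary. -/
theorem subset_carrier_of_closure {C : Set Plane} (hC : IsPreconnected C)
    (hd : ∀ i, Disjoint C (T.poly i).bdry) {i j : Option ι} (hij : i ≠ j) {p q : Plane}
    (hp : p ∈ closure C) (hq : q ∈ closure C) (hpi : p ∈ (T.poly i).bdry)
    (hqj : q ∈ (T.poly j).bdry) : C ⊆ T.carrier := by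
  intro x hx
  refine ⟨?_, ?_⟩
  · by_contra hout
    have hsub : C ⊆ (T.poly none).insideᶜ := fun y hy hi =>
      hout (Or.inr ((T.poly none).subset_inside hC (hd none) hy hi hx))
    have hcl := closure_minimal hsub (T.poly none).isOpen_inside.isClosed_compl
    have key : ∀ (l : Option ι) (z : Plane), z ∈ closure C → z ∈ (T.poly l).bdry → l = none := by
      intro l z hz hzl
      cases l with
      | none => rfl
      | some l => exact (hcl hz (T.obstacle_subset l (Or.inl hzl))).elim
    exact hij ((key i p hp hpi).trans (key j q hq hqj).symm)
  · rw [mem_iUnion]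
    rintro ⟨l, hl⟩
    have hsub : C ⊆ (T.poly (some l)).region :=
      ((T.poly (some l)).subset_inside hC (hd _) hx hl).trans subset_union_right
    have hcl := closure_minimal hsub (T.poly (some l)).isClosed_region
    have key : ∀ (m : Option ι) (z : Plane), z ∈ closure C → z ∈ (T.poly m).bdry →
        some l = m := by
      intro m z hz hzm
      by_contra h
      exact T.notMem_bdry_of_mem_region h (hcl hz) hzm
    exact hij ((key i p hp hpi).symm.trans (key j q hq hqj))

/-- The points of two disjoint unions of boundaries that are nearest to each other see each
other. -/
theorem sees_of_nearest {A : Set (Option ι)} {i j : Option ι} (hi : i ∈ A) (hj : j ∉ A)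
    {p q : Plane} (hp : p ∈ (T.poly i).bdry) (hq : q ∈ (T.poly j).bdry)
    (hmin : ∀ i' ∈ A, ∀ j' ∉ A, ∀ p' ∈ (T.poly i').bdry, ∀ q' ∈ (T.poly j').bdry,
      dist p q ≤ dist p' q') : T.Sees p q := by
  have hij : i ≠ j := fun h => hj (h ▸ hi)
  have hpq : p ≠ q := by
    rintro rfl
    exact hij (T.bdry_injective hp hq)
  have hd0 : 0 < dist p q := dist_pos.2 hpq
  have hdis : ∀ l, Disjoint (openSegment ℝ p q) (T.poly l).bdry := by
    intro l
    rw [disjoint_left]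
    intro z hz hl
    rw [openSegment_eq_image_lineMap] at hz
    obtain ⟨a, ha, rfl⟩ := hz
    by_cases hlA : l ∈ A
    · have := hmin l hlA j hj _ hl q hq
      rw [dist_lineMap_right, Real.norm_of_nonneg (by linarith [ha.2])] at this
      nlinarith [ha.1]
    · have := hmin i hi l hlA p hp _ hl
      rw [dist_left_lineMap, Real.norm_of_nonneg ha.1.le] at this
      nlinarith [ha.2]
  have hcl : closure (openSegment ℝ p q) = segment ℝ p q := closure_openSegment p q
  have hsub := T.subset_carrier_of_closure (convex_openSegment p q).isPreconnected hdis hij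
    (hcl ▸ left_mem_segment ℝ p q) (hcl ▸ right_mem_segment ℝ p q) hp hq
  have := closure_minimal hsub T.isClosed_carrier
  rwa [hcl] at this

end Terrain

/-! ### Half-lines -/

section HalfLine

variable {ι : Type*} (T : Terrain ι)

theorem dist_ray (v d : Plane) (a b : ℝ) : dist (ray v d a) (ray v d b) = |b - a| * ‖d‖ := by
  rw [dist_comm, dist_eq_norm, ray, ray, add_sub_add_left_eq_sub, ← sub_smul, norm_smul,
    Real.norm_eq_abs]

theorem continuous_ray (v d : Plane) : Continuous (ray v d) := by
  unfold ray; fun_prop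

theorem segment_ray (v d : Plane) {a b : ℝ} (hab : a ≤ b) :
    segment ℝ (ray v d a) (ray v d b) = ray v d '' Icc a b := by
  have h : ray v d = AffineMap.lineMap (k := ℝ) v (v + d) := by
    ext1 a; simp [ray, AffineMap.lineMap_apply, add_comm]
  rw [h, ← segment_eq_Icc hab, image_segment]

theorem sees_ray (v d : Plane) {a b : ℝ} (hab : a ≤ b) :
    T.Sees (ray v d a) (ray v d b) ↔ ∀ x ∈ Icc a b, ray v d x ∈ T.carrier := by
  rw [Terrain.Sees, segment_ray v d hab, image_subset_iff]; rfl

theorem sees_ray_add {T : Terrain ι} {v d : Plane} {a b : ℝ} (hab : a ≤ b)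
    (h : T.Sees (ray v d a) (ray v d b)) (hb : CanProgress T v d b) :
    ∃ x, b < x ∧ T.Sees (ray v d a) (ray v d x) := by
  obtain ⟨x, hx, hs⟩ := hb
  refine ⟨x, hx, ?_⟩
  rw [sees_ray T v d (hab.trans hx.le), ← Icc_union_Icc_eq_Icc hab hx.le]
  rw [sees_ray T v d hab] at h
  rw [sees_ray T v d hx.le] at hs
  rintro y (hy | hy)
  exacts [h y hy, hs y hy]

theorem isCompact_ray_preimage {K : Set Plane} (hK : IsCompact K) (v : Plane) {d : Plane}
    (hd : d ≠ 0) (a : ℝ) : IsCompact {x | a ≤ x ∧ ray v d x ∈ K} := by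
  have hd' : 0 < ‖d‖ := norm_pos_iff.2 hd
  refine Metric.isCompact_of_isClosed_isBounded
    (isClosed_Ici.inter (hK.isClosed.preimage (continuous_ray v d))) ?_
  rw [Metric.isBounded_iff]
  obtain ⟨C, hC⟩ := Metric.isBounded_iff.1 hK.isBounded
  refine ⟨C / ‖d‖, fun x hx y hy => ?_⟩
  rw [le_div_iff₀ hd', Real.dist_eq, abs_sub_comm, ← dist_ray v]
  exact hC hx.2 hy.2

/-- The robot cannot follow a half-line forever, and when it is stopped, it is on a boundary. -/
theorem exists_farthest_seen [Finite ι] {v d : Plane} (hd : d ≠ 0) {a : ℝ}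
    (ha : ray v d a ∈ T.carrier) :
    ∃ b, IsGreatest {x | a ≤ x ∧ T.Sees (ray v d a) (ray v d x)} b := by
  have hcl : IsClosed {x | a ≤ x ∧ T.Sees (ray v d a) (ray v d x)} :=
    isClosed_Ici.inter (T.isClosed_sees.preimage
      (continuous_const.prodMk (continuous_ray v d)))
  have hK : IsCompact {x | a ≤ x ∧ T.Sees (ray v d a) (ray v d x)} :=
    (isCompact_ray_preimage T.isCompact_carrier v hd a).of_isClosed_subset hcl
      fun x hx => ⟨hx.1, hx.2 (right_mem_segment ℝ _ _)⟩
  exact hK.exists_isGreatest ⟨a, le_rfl, T.sees_refl ha⟩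

theorem canProgress_of_eventually {v d : Plane} {a : ℝ}
    (h : ray v d a ∈ T.carrier)
    (hev : ∃ U ∈ nhds (ray v d a), ∀ x > a, ray v d x ∈ U → ray v d x ∈ T.carrier) :
    CanProgress T v d a := by
  obtain ⟨U, hU, hev⟩ := hev
  obtain ⟨ε, hε, hsub⟩ := Metric.mem_nhds_iff.1 ((continuous_ray v d).continuousAt hU)
  refine ⟨a + ε / 2, by linarith, ?_⟩
  rw [sees_ray T v d (by linarith)]
  intro x hx
  rcases hx.1.eq_or_lt with rfl | hlt
  · exact h
  · refine hev x hlt (hsub ?_)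
    rw [Metric.mem_ball, Real.dist_eq, abs_of_pos (by linarith)]
    linarith [hx.2]

theorem exists_bdry_of_isGreatest [Finite ι] {v d : Plane} {a b : ℝ}
    (h : IsGreatest {x | a ≤ x ∧ T.Sees (ray v d a) (ray v d x)} b) :
    ∃ i, ray v d b ∈ (T.poly i).bdry := by
  by_contra! hb
  have hc : ray v d b ∈ T.carrier := h.1.2 (right_mem_segment ℝ _ _)
  have := canProgress_of_eventually T hc ⟨_, T.mem_nhds_carrier hc hb, fun _ _ h => h⟩
  obtain ⟨x, hx, hs⟩ := sees_ray_add h.1.1 h.1.2 this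
  exact absurd (h.2 ⟨h.1.1.trans hx.le, hs⟩) (not_le.2 hx)

/-- Every point of the terrain sees a point of some boundary. -/
theorem exists_sees_bdry [Finite ι] {p : Plane} (hp : p ∈ T.carrier) :
    ∃ i, ∃ q ∈ (T.poly i).bdry, T.Sees p q := by
  obtain ⟨d, hd⟩ := exists_ne (0 : Plane)
  have h0 : ray p d 0 = p := by simp [ray]
  obtain ⟨b, hb⟩ := exists_farthest_seen T (v := p) hd (a := 0) (by rwa [h0])
  obtain ⟨i, hi⟩ := exists_bdry_of_isGreatest T hb
  have hs := hb.1.2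
  rw [h0] at hs
  exact ⟨i, _, hi, hs⟩

theorem farthest_mem_bdry (Q : SimplePolygon) {v d : Plane} {b : ℝ}
    (h : IsGreatest {x | 0 ≤ x ∧ ray v d x ∈ Q.region} b) : ray v d b ∈ Q.bdry := by
  refine h.1.2.resolve_right fun hi => ?_
  obtain ⟨ε, hε, hsub⟩ := Metric.mem_nhds_iff.1
    ((continuous_ray v d).continuousAt (Q.isOpen_inside.mem_nhds hi))
  have : b + ε / 2 ∈ {x | 0 ≤ x ∧ ray v d x ∈ Q.region} := by
    refine ⟨by linarith [h.1.1], Or.inr (hsub ?_)⟩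
    rw [Metric.mem_ball, Real.dist_eq, add_sub_cancel_left, abs_of_pos (by linarith)]
    linarith
  linarith [h.2 this]

/-- Beyond the last point of an obstacle on the half-line, there is free space. -/
theorem canProgress_of_obstacle [Finite ι] {v d : Plane} {b : ℝ} {i : ι}
    (h : IsGreatest {x | 0 ≤ x ∧ ray v d x ∈ (T.poly (some i)).region} b) :
    CanProgress T v d b := by
  have hb := farthest_mem_bdry _ h
  refine canProgress_of_eventually T (T.bdry_subset_carrier _ hb) ?_
  obtain ⟨U, hU, hUc⟩ := T.exists_nhds_mem_carrier (T.obstacle_subset i h.1.2) {i} fun j hj hjr =>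
    T.notMem_bdry_of_mem_region (i := j) (j := some i) (by simpa using hj) hjr hb
  refine ⟨U, hU, fun x hx hxU => hUc _ hxU ?_⟩
  rintro j rfl hxr
  exact absurd (h.2 ⟨h.1.1.trans hx.le, hxr⟩) (not_le.2 hx)

end HalfLine

/-! ### Squares and the quadtree -/

theorem dist_eq_sqrt (p q : Plane) :
    dist p q = √((p 0 - q 0) ^ 2 + (p 1 - q 1) ^ 2) := by
  rw [EuclideanSpace.dist_eq, Fin.sum_univ_two, Real.dist_eq, Real.dist_eq, sq_abs, sq_abs]

theorem sub_apply_le_dist (p q : Plane) (i : Fin 2) : p i - q i ≤ dist p q := by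
  rw [dist_eq_sqrt]
  refine (le_abs_self _).trans (Real.abs_le_sqrt ?_)
  fin_cases i
  · exact le_add_of_nonneg_right (sq_nonneg _)
  · exact le_add_of_nonneg_left (sq_nonneg _)

namespace Square

variable (S : Square)

theorem mem_carrier {p : Plane} : p ∈ S.carrier ↔
    (S.x ≤ p 0 ∧ p 0 ≤ S.x + S.side) ∧ S.y ≤ p 1 ∧ p 1 ≤ S.y + S.side := Iff.rfl

theorem carrier_eq : S.carrier =
    (EuclideanSpace.proj (𝕜 := ℝ) (0 : Fin 2) : Plane →L[ℝ] ℝ) ⁻¹' Icc S.x (S.x + S.side) ∩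
    (EuclideanSpace.proj (𝕜 := ℝ) (1 : Fin 2) : Plane →L[ℝ] ℝ) ⁻¹' Icc S.y (S.y + S.side) := rfl

theorem isClosed_carrier : IsClosed S.carrier := by
  rw [carrier_eq]
  exact (isClosed_Icc.preimage (ContinuousLinearMap.continuous _)).inter
    (isClosed_Icc.preimage (ContinuousLinearMap.continuous _))

theorem convex_carrier : Convex ℝ S.carrier := by
  rw [carrier_eq]
  exact ((convex_Icc _ _).linear_preimage _).inter ((convex_Icc _ _).linear_preimage _)

theorem side_nonneg {p : Plane} (hp : p ∈ S.carrier) : 0 ≤ S.side := by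
  rw [mem_carrier] at hp; linarith [hp.1.1, hp.1.2]

theorem dist_le {p q : Plane} (hp : p ∈ S.carrier) (hq : q ∈ S.carrier) :
    dist p q ≤ √2 * S.side := by
  have h0 := S.side_nonneg hp
  rw [mem_carrier] at hp hq
  rw [dist_eq_sqrt, Real.sqrt_le_left (by positivity), mul_pow, Real.sq_sqrt zero_le_two]
  have h1 : (p 0 - q 0) ^ 2 ≤ S.side ^ 2 := sq_le_sq' (by linarith) (by linarith)
  have h2 : (p 1 - q 1) ^ 2 ≤ S.side ^ 2 := sq_le_sq' (by linarith) (by linarith)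
  linarith

theorem isBounded_carrier : Bornology.IsBounded S.carrier :=
  Metric.isBounded_iff.2 ⟨_, fun _ hp _ hq => S.dist_le hp hq⟩

theorem diam_eq (h : 0 ≤ S.side) : S.diam = √2 * S.side := by
  apply le_antisymm
  · exact Metric.diam_le_of_forall_dist_le (by positivity) fun p hp q hq => S.dist_le hp hq
  · have key : dist (!₂[S.x, S.y] : Plane) !₂[S.x + S.side, S.y + S.side] ≤ S.diam :=
      Metric.dist_le_diam_of_mem S.isBounded_carrier (by simp [mem_carrier, h])
        (by simp [mem_carrier, h])
    refine le_trans (le_of_eq ?_) key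
    rw [dist_eq_sqrt]
    simp only [Matrix.cons_val_zero, Matrix.cons_val_one]
    rw [show (S.x - (S.x + S.side)) ^ 2 + (S.y - (S.y + S.side)) ^ 2 = 2 * S.side ^ 2 by ring,
      Real.sqrt_mul zero_le_two, Real.sqrt_sq h]

/-- The four children, as a list. -/
noncomputable def childList : List Square :=
  [⟨S.x, S.y, S.side / 2⟩, ⟨S.x + S.side / 2, S.y, S.side / 2⟩,
   ⟨S.x, S.y + S.side / 2, S.side / 2⟩, ⟨S.x + S.side / 2, S.y + S.side / 2, S.side / 2⟩]

variable {S}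

theorem mem_childList {S' : Square} : S' ∈ S.childList ↔ S' ∈ S.children := by
  simp [childList, children]

theorem side_of_mem_children {S' : Square} (h : S' ∈ S.children) : S'.side = S.side / 2 := by
  rcases h with rfl | rfl | rfl | rfl <;> rfl

theorem carrier_subset_of_mem_children {S' : Square} (h : S' ∈ S.children) :
    S'.carrier ⊆ S.carrier := by
  intro p hp
  have := S'.side_nonneg hp
  rw [mem_carrier] at hp ⊢
  rcases h with rfl | rfl | rfl | rfl <;> simp only at * <;>
    exact ⟨⟨by linarith [hp.1.1], by linarith [hp.1.2]⟩, by linarith [hp.2.1], by linarith [hp.2.2]⟩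

theorem exists_mem_children {p : Plane} (hp : p ∈ S.carrier) :
    ∃ S' ∈ S.children, p ∈ S'.carrier := by
  rw [mem_carrier] at hp
  simp only [children, mem_insert_iff, mem_singleton_iff, exists_eq_or_imp, exists_eq_left,
    mem_carrier]
  rcases le_total (p 0) (S.x + S.side / 2) with h0 | h0 <;>
    rcases le_total (p 1) (S.y + S.side / 2) with h1 | h1
  · exact Or.inl ⟨⟨hp.1.1, h0⟩, hp.2.1, h1⟩
  · exact Or.inr (Or.inr (Or.inl ⟨⟨hp.1.1, h0⟩, h1, by linarith [hp.2.2]⟩))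
  · exact Or.inr (Or.inl ⟨⟨h0, by linarith [hp.1.2]⟩, hp.2.1, h1⟩)
  · exact Or.inr (Or.inr (Or.inr ⟨⟨h0, by linarith [hp.1.2]⟩, h1, by linarith [hp.2.2]⟩))

end Square

/-- The larger side of the bounding box of a polygon is the side of a smallest square, and it is at
most the distance of two boundary points. -/
theorem SimplePolygon.exists_isSmallest (Q : SimplePolygon) :
    ∃ S : Square, S.IsSmallest Q.region ∧ ∃ p ∈ Q.bdry, ∃ q ∈ Q.bdry, S.side ≤ dist p q := by
  have hc : ∀ i : Fin 2, ContinuousOn (fun p : Plane => p i) Q.bdry := fun i =>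
    (EuclideanSpace.proj (𝕜 := ℝ) i : Plane →L[ℝ] ℝ).continuous.continuousOn
  have hmin := fun i => Q.isCompact_bdry.exists_isMinOn Q.bdry_nonempty (hc i)
  have hmax := fun i => Q.isCompact_bdry.exists_isMaxOn Q.bdry_nonempty (hc i)
  choose a ha hamin using hmin
  choose b hb hbmax using hmax
  set σ := max (b 0 0 - a 0 0) (b 1 1 - a 1 1)
  have hle0 : b 0 0 - a 0 0 ≤ σ := le_max_left _ _
  have hle1 : b 1 1 - a 1 1 ≤ σ := le_max_right _ _
  have hsub : Q.bdry ⊆ (⟨a 0 0, a 1 1, σ⟩ : Square).carrier := by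
    intro p hp
    rw [Square.mem_carrier]
    exact ⟨⟨hamin 0 hp, by linarith [show p 0 ≤ b 0 0 from hbmax 0 hp]⟩, hamin 1 hp,
      by linarith [show p 1 ≤ b 1 1 from hbmax 1 hp]⟩
  refine ⟨⟨a 0 0, a 1 1, σ⟩, ⟨?_, ?_⟩, ?_⟩
  · exact Q.region_subset_closure_convexHull.trans
      (closure_minimal (convexHull_min hsub (Square.convex_carrier _)) (Square.isClosed_carrier _))
  · intro S' hS'
    have h := fun {p : Plane} (hp : p ∈ Q.bdry) => S'.mem_carrier.1 (hS' (Or.inl hp))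
    exact max_le (by linarith [(h (ha 0)).1.1, (h (hb 0)).1.2])
      (by linarith [(h (ha 1)).2.1, (h (hb 1)).2.2])
  · rcases max_choice (b 0 0 - a 0 0) (b 1 1 - a 1 1) with h | h
    · exact ⟨b 0, hb 0, a 0, ha 0, h.le.trans (sub_apply_le_dist _ _ _)⟩
    · exact ⟨b 1, hb 1, a 1, ha 1, h.le.trans (sub_apply_le_dist _ _ _)⟩

theorem Square.IsSmallest.side_pos {Q : SimplePolygon} {S : Square} (h : S.IsSmallest Q.region) :
    0 < S.side := by
  obtain ⟨p, hp, q, hq, hpq⟩ := Q.bdry_nontrivial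
  have := (dist_pos.2 hpq).trans_le (S.dist_le (h.1 (Or.inl hp)) (h.1 (Or.inl hq)))
  exact pos_of_mul_pos_right this (Real.sqrt_nonneg 2)

/-- The potential of a terminal square of side `x`, for the scale `μ`. -/
noncomputable def squarePotential (μ x : ℝ) : ℝ := (x - μ) ^ 2 / (2 * μ)

theorem squarePotential_nonneg {μ : ℝ} (hμ : 0 < μ) (x : ℝ) : 0 ≤ squarePotential μ x := by
  unfold squarePotential; positivity

/-- Splitting a square of side `x` raises the number of squares by `3`, the sum of the sides by `x`,
and leaves the area unchanged. -/
theorem squarePotential_split {μ : ℝ} (hμ : 0 < μ) (x : ℝ) :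
    4 * squarePotential μ (x / 2) = squarePotential μ x - x + 3 * μ / 2 := by
  unfold squarePotential
  field_simp
  ring

/-- The potential of a list of squares. -/
noncomputable def listPotential (μ : ℝ) (l : List Square) : ℝ :=
  (l.map fun S => squarePotential μ S.side).sum

theorem listPotential_nonneg {μ : ℝ} (hμ : 0 < μ) (l : List Square) : 0 ≤ listPotential μ l :=
  List.sum_nonneg (by
    simp only [List.mem_map]
    rintro _ ⟨S, _, rfl⟩
    exact squarePotential_nonneg hμ _)

theorem listPotential_childList (μ : ℝ) (S : Square) :
    listPotential μ S.childList = 4 * squarePotential μ (S.side / 2) := by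
  simp [listPotential, Square.childList]; ring

theorem exists_split_list {μ : ℝ} (hμ : 0 < μ) {leaves : Set Square} {l : List Square}
    (hl : ∀ S ∈ leaves, S ∈ l) {S : Square} (hS : S ∈ leaves) :
    ∃ l' : List Square, (∀ S' ∈ Square.split leaves S, S' ∈ l') ∧
      listPotential μ l' = listPotential μ l - S.side + 3 * μ / 2 := by
  classical
  refine ⟨S.childList ++ l.erase S, ?_, ?_⟩
  · rintro S' (⟨h, hne⟩ | h)
    · exact List.mem_append_right _ ((List.mem_erase_of_ne hne).2 (hl S' h))
    · exact List.mem_append_left _ (Square.mem_childList.2 h)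
  · have h1 := ((List.perm_cons_erase (hl S hS)).map fun S => squarePotential μ S.side).sum_eq
    have h2 := listPotential_childList μ S
    rw [squarePotential_split hμ] at h2
    simp only [listPotential, List.map_append, List.sum_append, List.map_cons, List.sum_cons] at *
    linarith

/-! ### Approachability -/

variable {ι : Type*} {T : Terrain ι}

/-- Nothing becomes approachable by a call of the procedure: squares shrink, and new polygons become
known. -/
theorem SomethingApproachable.of_split {leaves : Set Square} {known : Set (Option ι)} {S : Square}
    {j : Option ι} {r : Plane} (hS : S ∈ leaves)
    (h : SomethingApproachable T (Square.split leaves S) (insert j known) r) :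
    SomethingApproachable T leaves known r := by
  obtain ⟨S', i, q, hS', hi, hq, hqS, hsee, hd⟩ := h
  have hi' : i ∉ known := fun h => hi (mem_insert_of_mem _ h)
  rcases hS' with ⟨hS', -⟩ | hc
  · exact ⟨S', i, q, hS', hi', hq, hqS, hsee, hd⟩
  · have hsub := Square.carrier_subset_of_mem_children hc
    refine ⟨S, i, q, hS, hi', hq, hsub hqS, hsee, hd.trans ?_⟩
    exact mul_le_mul_of_nonneg_left (Metric.diam_mono hsub S.isBounded_carrier) zero_le_two

theorem isClosed_approachable [Finite ι] {leaves : Set Square} (hfin : leaves.Finite)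
    (known : Set (Option ι)) : IsClosed {r | SomethingApproachable T leaves known r} := by
  have : {r | SomethingApproachable T leaves known r} = ⋃ S ∈ leaves, ⋃ j ∈ knownᶜ,
      Prod.fst '' ((univ ×ˢ ((T.poly j).bdry ∩ S.carrier)) ∩
        {z : Plane × Plane | T.Sees z.1 z.2 ∧ dist z.1 z.2 ≤ 2 * S.diam}) := by
    ext r
    simp only [SomethingApproachable, Approachable, mem_iUnion, mem_image, Prod.exists,
      mem_inter_iff, mem_prod, mem_univ, mem_ofPred_eq, exists_and_right, exists_eq_right, mem_compl_iff]
    constructor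
    · rintro ⟨S, j, q, h1, h2, h3, h4, h5, h6⟩
      exact ⟨S, h1, j, h2, q, ⟨trivial, h3, h4⟩, h5, h6⟩
    · rintro ⟨S, h1, j, h2, q, ⟨-, h3, h4⟩, h5, h6⟩
      exact ⟨S, j, q, h1, h2, h3, h4, h5, h6⟩
  rw [this]
  refine hfin.isClosed_biUnion fun S _ => (Set.toFinite _).isClosed_biUnion fun j _ => ?_
  have hK : IsCompact ((T.poly j).bdry ∩ S.carrier) :=
    (T.poly j).isCompact_bdry.inter_right S.isClosed_carrier
  have hcl : IsClosed {z : Plane × Plane | T.Sees z.1 z.2 ∧ dist z.1 z.2 ≤ 2 * S.diam} :=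
    T.isClosed_sees.inter (isClosed_le continuous_dist continuous_const)
  have : IsCompact ((T.carrier ×ˢ ((T.poly j).bdry ∩ S.carrier)) ∩
      {z : Plane × Plane | T.Sees z.1 z.2 ∧ dist z.1 z.2 ≤ 2 * S.diam}) :=
    (T.isCompact_carrier.prod hK).inter_right hcl
  convert (this.image continuous_fst).isClosed using 2
  ext ⟨p, q⟩
  simp only [mem_inter_iff, mem_prod, mem_univ, true_and, mem_ofPred_eq]
  exact ⟨fun h => ⟨⟨h.2.1 (left_mem_segment ℝ p q), h.1⟩, h.2⟩, fun h => ⟨h.1.2, h.2⟩⟩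

/-- On a boundary run, there is a first position from which something is approachable. -/
theorem exists_first_approachable [Finite ι] {leaves : Set Square} (hfin : leaves.Finite)
    (known : Set (Option ι)) (Q : SimplePolygon) {a b : ℝ} (ha : 0 ≤ a)
    (h : ∃ x ∈ Icc a b, SomethingApproachable T leaves known (Q.pos x)) :
    ∃ t, IsLeast {x | x ∈ Icc a b ∧ SomethingApproachable T leaves known (Q.pos x)} t := by
  have hcl : IsClosed (Icc a b ∩ Q.pos ⁻¹' {r | SomethingApproachable T leaves known r}) :=
    (Q.continuousOn_pos.mono fun x hx => ha.trans hx.1).preimage_isClosed_of_isClosed isClosed_Icc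
      (isClosed_approachable hfin known)
  obtain ⟨x, hx⟩ := h
  exact (isCompact_Icc.of_isClosed_subset hcl inter_subset_left).exists_isLeast ⟨x, hx⟩

/-- If every terminal square has a parent that contains a point of a known boundary, then, as long
as there are unknown polygons, something is approachable from some known boundary: the nearest pair
of a known and an unknown boundary point is visible, and by its minimality it is not longer than the
diameter of the parent of the terminal square containing the unknown point. -/
theorem exists_approachable [Finite ι] {leaves : Set Square} {known : Set (Option ι)}
    (hk : known.Nonempty) (hu : known ≠ univ)
    (hcover : (T.poly none).region ⊆ ⋃ S ∈ leaves, S.carrier)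
    (hparent : ∀ S ∈ leaves, ∃ S' : Square, S ∈ S'.children ∧ ∃ p ∈ S'.carrier, ∃ i ∈ known,
      p ∈ (T.poly i).bdry) :
    ∃ i ∈ known, ∃ p ∈ (T.poly i).bdry, SomethingApproachable T leaves known p := by
  have hcpt : ∀ A : Set (Option ι), IsCompact (⋃ i ∈ A, (T.poly i).bdry) := fun A =>
    (Set.toFinite A).isCompact_biUnion fun i _ => (T.poly i).isCompact_bdry
  have hne : ∀ A : Set (Option ι), A.Nonempty → (⋃ i ∈ A, (T.poly i).bdry).Nonempty := by
    rintro A ⟨i, hi⟩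
    obtain ⟨p, hp⟩ := (T.poly i).bdry_nonempty
    exact ⟨p, mem_biUnion hi hp⟩
  have hu' : (knownᶜ).Nonempty := nonempty_compl.2 hu
  obtain ⟨⟨p, q⟩, ⟨hp, hq⟩, hmin⟩ := ((hcpt known).prod (hcpt knownᶜ)).exists_isMinOn
    ((hne _ hk).prod (hne _ hu')) (f := fun z : Plane × Plane => dist z.1 z.2)
    continuous_dist.continuousOn
  dsimp only at hp hq
  obtain ⟨i, hi, hp⟩ := mem_iUnion₂.1 hp
  obtain ⟨j, hj, hq⟩ := mem_iUnion₂.1 hq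
  have hmin' : ∀ i' ∈ known, ∀ j' ∉ known, ∀ p' ∈ (T.poly i').bdry, ∀ q' ∈ (T.poly j').bdry,
      dist p q ≤ dist p' q' := fun i' hi' j' hj' p' hp' q' hq' =>
    isMinOn_iff.1 hmin (p', q') ⟨mem_iUnion₂.2 ⟨i', hi', hp'⟩, mem_iUnion₂.2 ⟨j', hj', hq'⟩⟩
  obtain ⟨S, hS, hqS⟩ := mem_iUnion₂.1
    (hcover (T.carrier_subset_region (T.bdry_subset_carrier j hq)))
  obtain ⟨S', hc, p', hp', i', hi', hpi'⟩ := hparent S hS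
  refine ⟨i, hi, p, hp, S, j, q, hS, hj, hq, hqS, T.sees_of_nearest hi hj hp hq hmin', ?_⟩
  rw [S.diam_eq (S.side_nonneg hqS), Square.side_of_mem_children hc]
  have := S'.dist_le hp' (Square.carrier_subset_of_mem_children hc hqS)
  linarith [hmin' i' hi' j hj p' hpi' q hq]

/-! ### Extending the trajectory -/

theorem getLast?_append_of {α : Type*} {l m : List α} {a : α} (h : m.getLast? = some a) :
    (l ++ m).getLast? = some a := by
  rw [List.getLast?_append, h]; rfl

theorem append_run {path : List Plane} {p : Plane} (hl : path.getLast? = some p)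
    (htr : polylineTrace path ⊆ T.carrier) (i : Option ι) {s t : ℝ} (hs : 0 ≤ s) (hst : s ≤ t)
    (hsee : T.Sees p ((T.poly i).pos s)) :
    (path ++ (T.poly i).run s t).getLast? = some ((T.poly i).pos t) ∧
    polylineTrace path ⊆ polylineTrace (path ++ (T.poly i).run s t) ∧
    polylineTrace (path ++ (T.poly i).run s t) ⊆ T.carrier ∧
    (T.poly i).pos '' Icc s t ⊆ polylineTrace (path ++ (T.poly i).run s t) ∧
    polylineLength (path ++ (T.poly i).run s t) =
      polylineLength path + dist p ((T.poly i).pos s) + ((T.poly i).arc t - (T.poly i).arc s) := by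
  have hh := (T.poly i).head?_run s t
  rw [polylineTrace_append hl hh, polylineLength_append hl hh,
    (T.poly i).polylineTrace_run hs hst, (T.poly i).polylineLength_run hs hst]
  refine ⟨getLast?_append_of ((T.poly i).getLast?_run s t),
    subset_union_left.trans subset_union_left, ?_, subset_union_right, rfl⟩
  refine union_subset (union_subset htr hsee) ?_
  rintro _ ⟨x, hx, rfl⟩
  exact T.bdry_subset_carrier i ((T.poly i).pos_mem_bdry (hs.trans hx.1))

theorem sees_pos_self (i : Option ι) {s : ℝ} (hs : 0 ≤ s) :
    T.Sees ((T.poly i).pos s) ((T.poly i).pos s) :=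
  T.sees_refl (T.bdry_subset_carrier i ((T.poly i).pos_mem_bdry hs))

/-! ### The preliminary walk -/

/-- What holds during the preliminary walk. The set `V` in `budget` consists of the polygons that
have been gone around; the half-line does not meet them any more. -/
structure WalkInv (T : Terrain ι) (v d : Plane) (path : List Plane) (τ : ℝ) : Prop where
  nonneg : 0 ≤ τ
  mem_carrier : ray v d τ ∈ T.carrier
  last : path.getLast? = some (ray v d τ)
  trace_subset : polylineTrace path ⊆ T.carrier
  budget : ∃ V : Finset (Option ι),
    polylineLength path ≤ τ * ‖d‖ + ∑ i ∈ V, 2 * (T.poly i).perimeter ∧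
    (∀ i ∈ V, ∀ x, 0 ≤ x → ray v d x ∈ (T.poly i).region → x ≤ τ) ∧
    (V.Nonempty → CanProgress T v d τ)

theorem WalkInv.init {v d : Plane} (hv : v ∈ T.carrier) : WalkInv T v d [v] 0 where
  nonneg := le_rfl
  mem_carrier := by simpa [ray] using hv
  last := by simp [ray]
  trace_subset := by simpa [polylineTrace] using hv
  budget := ⟨∅, by simp [polylineLength], by simp, by simp⟩

/-- The parameter on the half-line does not decrease in a round, and increases if the robot could
progress. -/
theorem WalkRound.le {v d : Plane} {path path' : List Plane} {τ τu t : ℝ} {i : Option ι}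
    (h : WalkRound T v d path τ i t τu path') (h0 : 0 ≤ τ) :
    τ ≤ τu ∧ (CanProgress T v d τ → τ < τu) := by
  obtain ⟨τ', s, hτ', hs, hsτ, hτu, -⟩ := h
  have hle : τ' ≤ τu := hτu.2 ⟨h0.trans hτ'.1.1, by
    rw [← hsτ]; exact Or.inl ((T.poly i).pos_mem_bdry hs.1)⟩
  refine ⟨hτ'.1.1.trans hle, ?_⟩
  rintro ⟨x, hx, hsee⟩
  exact (hx.trans_le (hτ'.2 ⟨hx.le, hsee⟩)).trans_le hle

theorem WalkInv.round {v d : Plane} {path path' : List Plane} {τ τu t : ℝ} {i : Option ι}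
    (hI : WalkInv T v d path τ) (h : WalkRound T v d path τ i t τu path') :
    0 ≤ τu ∧ ray v d τu ∈ (T.poly i).bdry ∧ 0 ≤ t ∧ (T.poly i).pos t = ray v d τu ∧
    path'.getLast? = some (ray v d τu) ∧ polylineTrace path' ⊆ T.carrier ∧
    ∃ V : Finset (Option ι),
      polylineLength path' ≤ τu * ‖d‖ + ∑ i ∈ V, 2 * (T.poly i).perimeter ∧
      ∀ i ∈ V, ∀ x, 0 ≤ x → ray v d x ∈ (T.poly i).region → x ≤ τu := by
  classical
  obtain ⟨hτu0, hlt⟩ := h.le hI.nonneg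
  obtain ⟨τ', s, hτ', hs, hsτ, hτu, ht, htu, rfl⟩ := h
  have hs' : s ≤ s + (T.poly i).n := by linarith [(T.poly i).n_pos]
  have hmem : ray v d τ' ∈ (T.poly i).region := by
    rw [← hsτ]; exact Or.inl ((T.poly i).pos_mem_bdry hs.1)
  have hle : τ' ≤ τu := hτu.2 ⟨hI.nonneg.trans hτ'.1.1, hmem⟩
  obtain ⟨l1, -, c1, -, e1⟩ := append_run hI.last hI.trace_subset i hs.1 hs'
    (by rw [hsτ]; exact hτ'.1.2)
  rw [(T.poly i).pos_add_n hs.1] at l1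
  obtain ⟨l2, -, c2, -, e2⟩ := append_run l1 c1 i hs.1 ht.1 (sees_pos_self i hs.1)
  refine ⟨hI.nonneg.trans hτu0, farthest_mem_bdry _ hτu, hs.1.trans ht.1, htu, htu ▸ l2, c2, ?_⟩
  obtain ⟨V, hV, hpast, hprog⟩ := hI.budget
  have hiV : i ∉ V := by
    intro hi
    obtain ⟨x, hx, hsee⟩ := hprog ⟨i, hi⟩
    have := hx.trans_le (hτ'.2 ⟨hx.le, hsee⟩)
    exact absurd (hpast i hi τ' (hI.nonneg.trans hτ'.1.1) hmem) (not_le.2 this)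
  refine ⟨insert i V, ?_, ?_⟩
  · rw [Finset.sum_insert hiV, e2, e1, hsτ, dist_self, dist_ray,
      abs_of_nonneg (sub_nonneg.2 hτ'.1.1)]
    have h1 := (T.poly i).arc_mono (hs.1.trans ht.1) ht.2.le
    rw [(T.poly i).arc_add_n hs.1] at h1 ⊢
    have h2 : τ' * ‖d‖ ≤ τu * ‖d‖ := mul_le_mul_of_nonneg_right hle (norm_nonneg d)
    linarith
  · intro j hj x hx hr
    rcases Finset.mem_insert.1 hj with rfl | hj
    · exact hτu.2 ⟨hx, hr⟩
    · exact (hpast j hj x hx hr).trans hτu0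

theorem WalkInv.exists_round [Finite ι] {v d : Plane} (hd : d ≠ 0) {path : List Plane} {τ : ℝ}
    (hI : WalkInv T v d path τ) : ∃ i t τu path', WalkRound T v d path τ i t τu path' := by
  obtain ⟨τ', hτ'⟩ := exists_farthest_seen T hd hI.mem_carrier
  obtain ⟨i, hi⟩ := exists_bdry_of_isGreatest T hτ'
  obtain ⟨s, hs, hsτ⟩ := (T.poly i).exists_pos_eq hi
  obtain ⟨τu, hτu⟩ := (isCompact_ray_preimage (T.poly i).isCompact_region v hd 0).exists_isGreatest
    ⟨τ', hI.nonneg.trans hτ'.1.1, Or.inl hi⟩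
  obtain ⟨t, ht, htu⟩ := (T.poly i).exists_pos_eq_of_mem_bdry (farthest_mem_bdry _ hτu) hs
  exact ⟨i, t, τu, _, τ', s, hτ', hs, hsτ, hτu, ht, htu, rfl⟩

/-- The preliminary walk can end only at the outer polygon. -/
theorem WalkRound.eq_none [Finite ι] {v d : Plane} {path path' : List Plane} {τ τu t : ℝ}
    {i : Option ι} (h : WalkRound T v d path τ i t τu path') (hb : ¬ CanProgress T v d τu) :
    i = none := by
  obtain ⟨_, _, _, _, _, hτu, _⟩ := h
  cases i with
  | none => rfl
  | some i => exact (hb (canProgress_of_obstacle T hτu)).elim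

/-! ### The recursive procedure -/

/-- The length of what the active calls have still to travel, apart from further calls: the rest of
each boundary, and the approaching segments in the backward direction. -/
noncomputable def pending (T : Terrain ι) : List (Frame ι) → ℝ
  | [] => 0
  | [f] => (T.poly f.i).arc (f.start + (T.poly f.i).n) - (T.poly f.i).arc f.now
  | f :: g :: r => (T.poly f.i).arc (f.start + (T.poly f.i).n) - (T.poly f.i).arc f.now +
      dist ((T.poly f.i).pos f.start) ((T.poly g.i).pos g.now) + pending T (g :: r)

/-- What is set aside for the unknown polygons: two turns around each of them, and `c`. -/
noncomputable def reserve [Fintype ι] (T : Terrain ι) (c : ℝ) (known : Set (Option ι)) : ℝ :=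
  ∑ i, knownᶜ.indicator (fun i => 2 * (T.poly i).perimeter + c) i

theorem reserve_nonneg [Fintype ι] {c : ℝ} (hc : 0 ≤ c) (known : Set (Option ι)) :
    0 ≤ reserve T c known :=
  Finset.sum_nonneg fun i _ => indicator_nonneg
    (fun i _ => by have := (T.poly i).perimeter_nonneg; positivity) i

theorem reserve_insert [Fintype ι] (c : ℝ) {known : Set (Option ι)} {j : Option ι}
    (hj : j ∉ known) :
    reserve T c known = reserve T c (insert j known) + (2 * (T.poly j).perimeter + c) := by
  classical
  rw [reserve, reserve, ← Finset.add_sum_erase _ _ (Finset.mem_univ j),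
    ← Finset.add_sum_erase (s := Finset.univ) (f := (insert j known)ᶜ.indicator _)
      (h := Finset.mem_univ j)]
  rw [indicator_of_mem (show j ∈ knownᶜ from hj),
    indicator_of_notMem (show j ∉ (insert j known)ᶜ by simp)]
  have : ∀ i ∈ Finset.univ.erase j, knownᶜ.indicator (fun i => 2 * (T.poly i).perimeter + c) i =
      (insert j known)ᶜ.indicator (fun i => 2 * (T.poly i).perimeter + c) i := by
    intro i hi
    have hne := Finset.ne_of_mem_erase hi
    by_cases hk : i ∈ known <;> simp [indicator, hk, hne]
  rw [Finset.sum_congr rfl this]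
  ring

theorem reserve_none [Fintype ι] (c : ℝ) :
    reserve T c {none} + 2 * (T.poly none).perimeter =
      2 * T.perimeter + Fintype.card ι * c := by
  rw [reserve, Terrain.perimeter, Fintype.sum_option, Fintype.sum_option]
  simp only [indicator, mem_compl_iff, mem_singleton_iff, not_true_eq_false, if_false, reduceCtorEq,
    not_false_eq_true, if_true, Finset.sum_add_distrib, Finset.sum_const, Finset.card_univ,
    nsmul_eq_mul, Finset.mul_sum, mul_add]
  ring

/-- What holds during the recursive procedure. The fields `tested_active` and `tested` say where
nothing is approachable: on the part of the boundary that an active call has tested, and on the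
whole boundary if the call has been completed. The bound `B` in `budget` covers the distance
travelled, the pending distance, the reserve, and the potential of the terminal squares, which are
among those in the list `l`. -/
structure ExploreInv [Fintype ι] (T : Terrain ι) (B : ℝ) (path : List Plane)
    (leaves : Set Square) (known : Set (Option ι)) (stack : List (Frame ι)) : Prop where
  trace_subset : polylineTrace path ⊆ T.carrier
  covered : ∀ i ∈ known, (T.poly i).bdry ⊆ polylineTrace path
  known_nonempty : known.Nonempty
  cover : (T.poly none).region ⊆ ⋃ S ∈ leaves, S.carrier
  parent : ∀ S ∈ leaves, ∃ S' : Square, S ∈ S'.children ∧ ∃ p ∈ S'.carrier, ∃ i ∈ known,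
    p ∈ (T.poly i).bdry
  times : ∀ f ∈ stack, 0 ≤ f.start ∧ f.start ≤ f.now ∧ f.now ≤ f.start + (T.poly f.i).n
  returns : stack.IsChain fun f g => T.Sees ((T.poly f.i).pos f.start) ((T.poly g.i).pos g.now)
  last : ∀ f, stack.head? = some f → path.getLast? = some ((T.poly f.i).pos f.now)
  tested_active : ∀ f ∈ stack, ∀ x ∈ Ico f.start f.now,
    ¬ SomethingApproachable T leaves known ((T.poly f.i).pos x)
  tested : ∀ i ∈ known, (∃ f ∈ stack, f.i = i) ∨
    ∀ p ∈ (T.poly i).bdry, ¬ SomethingApproachable T leaves known p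
  budget : ∃ μ : ℝ, 0 < μ ∧ ∃ l : List Square, (∀ S ∈ leaves, S ∈ l) ∧
    polylineLength path + pending T stack + reserve T (4 * √2 * (3 * μ / 2)) known +
      4 * √2 * listPotential μ l ≤ B

variable [Fintype ι]

theorem ExploreInv.leaves_finite {B : ℝ} {path : List Plane} {leaves : Set Square}
    {known : Set (Option ι)} {stack : List (Frame ι)}
    (h : ExploreInv T B path leaves known stack) : leaves.Finite := by
  obtain ⟨_, _, l, hl, _⟩ := h.budget
  exact l.finite_toSet.subset hl

/-- The choice of the scale. The left-hand side is what is to be set aside for the approaching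
segments when the root square, of side `σ`, has been split and `k` polygons are unknown. It is least
for `μ = σ / √(3k + 4)`, the quadratic mean of the sides of the final `3k + 4` terminal squares, and
then it is `4 √2 σ (√(3k + 4) - 2)`. -/
theorem exists_scale {σ k : ℝ} (hσ : 0 < σ) (hk : 0 ≤ k) :
    ∃ μ : ℝ, 0 < μ ∧ 4 * √2 * (4 * squarePotential μ (σ / 2)) + k * (4 * √2 * (3 * μ / 2)) ≤
      12 * σ * √k := by
  set w := √(3 * k + 4)
  have hw : 0 < w := Real.sqrt_pos.2 (by positivity)
  have hw2 : w ^ 2 = 3 * k + 4 := Real.sq_sqrt (by positivity)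
  have hμ : 0 < σ / w := by positivity
  refine ⟨σ / w, hμ, ?_⟩
  have e : 4 * squarePotential (σ / w) (σ / 2) + k * (3 * (σ / w) / 2) = σ * (w - 2) := by
    have hk' : k = (w ^ 2 - 4) / 3 := by linarith
    rw [hk', squarePotential]
    field_simp
    ring
  have hsqrt : √2 * (w - 2) ≤ 3 * √k := by
    have h1 : w ≤ √(3 * k) + 2 := by
      rw [Real.sqrt_le_left (by positivity), add_sq, Real.sq_sqrt (by positivity)]
      linarith [Real.sqrt_nonneg (3 * k)]
    have h2 : √2 * √(3 * k) ≤ 3 * √k := by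
      rw [← Real.sqrt_mul zero_le_two, Real.sqrt_le_left (by positivity), mul_pow,
        Real.sq_sqrt hk]
      linarith
    nlinarith [Real.sqrt_nonneg 2]
  calc _ = 4 * σ * (√2 * (w - 2)) := by linear_combination 4 * √2 * e
    _ ≤ 4 * σ * (3 * √k) := by gcongr
    _ = 12 * σ * √k := by ring

theorem ExploreInv.start {v d : Plane} (hv : v ∈ T.carrier) {path path' : List Plane} {τ τu t : ℝ}
    {i : Option ι} {S : Square} (hI : WalkInv T v d path τ)
    (h : WalkRound T v d path τ i t τu path') (hb : ¬ CanProgress T v d τu)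
    (hS : S.IsSmallest (T.poly i).region) :
    ExploreInv T (5 * T.perimeter + 12 * T.hullDiam * √(Fintype.card ι))
      (path' ++ (T.poly i).run t (t + (T.poly i).n)) S.children {i} [⟨i, t, t⟩] := by
  classical
  obtain rfl := h.eq_none hb
  obtain ⟨hτu, hbd, ht, htu, hlast, htr, V, hV, -⟩ := hI.round h
  have hn := (T.poly none).n_pos
  obtain ⟨l1, -, c1, cov1, e1⟩ := append_run hlast htr none ht
    (by linarith : t ≤ t + (T.poly none).n)
    (htu ▸ sees_pos_self none ht)
  rw [(T.poly none).image_pos_turn ht] at cov1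
  refine ⟨c1, ?_, singleton_nonempty _, ?_, ?_, ?_, List.IsChain.singleton _, ?_, ?_, ?_, ?_⟩
  · rintro _ rfl; exact cov1
  · intro p hp
    obtain ⟨S', hS', hp'⟩ := Square.exists_mem_children (hS.1 hp)
    exact mem_biUnion hS' hp'
  · exact fun S' hS' => ⟨S, hS', _, hS.1 (Or.inl hbd), none, rfl, hbd⟩
  · simp only [List.mem_singleton, forall_eq]
    exact ⟨ht, le_rfl, by linarith⟩
  · simp only [List.head?_cons, Option.some.injEq, forall_eq']
    rw [l1, (T.poly none).pos_add_n ht]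
  · simp only [List.mem_singleton, forall_eq]
    exact fun x hx => absurd (hx.1.trans_lt hx.2) (lt_irrefl _)
  · rintro _ rfl
    exact Or.inl ⟨_, List.mem_singleton_self _, rfl⟩
  · obtain ⟨μ, hμ, hle⟩ := exists_scale hS.side_pos (Nat.cast_nonneg (Fintype.card ι))
    refine ⟨μ, hμ, S.childList, fun S' hS' => Square.mem_childList.2 hS', ?_⟩
    have hσ : S.side ≤ T.hullDiam := by
      obtain ⟨S₀, hS₀, p, hp, q, hq, hpq⟩ := (T.poly none).exists_isSmallest
      exact (hS.2 S₀ hS₀.1).trans (hpq.trans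
        (T.dist_le_hullDiam (T.bdry_subset_carrier _ hp) (T.bdry_subset_carrier _ hq)))
    have h1 : 12 * S.side * √(Fintype.card ι) ≤ 12 * T.hullDiam * √(Fintype.card ι) := by gcongr
    have h2 : ∑ i ∈ V, 2 * (T.poly i).perimeter ≤ 2 * T.perimeter := by
      rw [Terrain.perimeter, Finset.mul_sum]
      exact Finset.sum_le_sum_of_subset_of_nonneg (Finset.subset_univ V)
        fun i _ _ => by have := (T.poly i).perimeter_nonneg; positivity
    -- The half-line from `v` to the end of the walk is a chord of the outer polygon.
    have h3 : τu * ‖d‖ ≤ T.perimeter := by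
      have h := (T.poly none).dist_le_perimeter (T.carrier_subset_region hv) (Or.inl hbd)
      have e : dist v (ray v d τu) = τu * ‖d‖ := by
        have := dist_ray v d 0 τu
        rwa [sub_zero, abs_of_nonneg hτu, show ray v d 0 = v by simp [ray]] at this
      rw [e] at h
      exact h.trans (Finset.single_le_sum (f := fun i => (T.poly i).perimeter)
        (fun i _ => (T.poly i).perimeter_nonneg) (Finset.mem_univ none))
    have h4 := reserve_none (T := T) (4 * √2 * (3 * μ / 2))
    have h5 := (T.poly none).arc_add_n ht
    rw [e1, htu, dist_self, listPotential_childList, pending]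
    linarith

theorem ExploreInv.approach {B : ℝ} {path : List Plane} {leaves : Set Square}
    {known : Set (Option ι)} {i j : Option ι} {s now t w : ℝ} {rest : List (Frame ι)} {S : Square}
    (hI : ExploreInv T B path leaves known (⟨i, s, now⟩ :: rest))
    (first : IsLeast {x | x ∈ Icc now (s + (T.poly i).n) ∧
      SomethingApproachable T leaves known ((T.poly i).pos x)} t)
    (hw : w ∈ Ico 0 ((T.poly j).n : ℝ))
    (app : Approachable T leaves known ((T.poly i).pos t) S j ((T.poly j).pos w)) :
    ExploreInv T B (path ++ (T.poly i).run now t ++ (T.poly j).run w (w + (T.poly j).n))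
      (Square.split leaves S) (insert j known) (⟨j, w, w⟩ :: ⟨i, s, t⟩ :: rest) := by
  obtain ⟨hS, hj, hjb, hqS, hsee, hdist⟩ := app
  obtain ⟨hs0, hsn, hnt⟩ := hI.times _ List.mem_cons_self
  dsimp only at hs0 hsn hnt
  have htn : now ≤ t := first.1.1.1
  have hn := (T.poly j).n_pos
  obtain ⟨l1, m1, c1, -, e1⟩ := append_run (hI.last _ rfl) hI.trace_subset i (hs0.trans hsn) htn
    (sees_pos_self i (hs0.trans hsn))
  obtain ⟨l2, m2, c2, cov2, e2⟩ := append_run l1 c1 j hw.1 (by linarith : w ≤ w + (T.poly j).n) hsee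
  rw [(T.poly j).image_pos_turn hw.1] at cov2
  refine ⟨c2, ?_, insert_nonempty _ _, ?_, ?_, ?_, ?_, ?_, ?_, ?_, ?_⟩
  · rintro l (rfl | hl)
    · exact cov2
    · exact (hI.covered l hl).trans (m1.trans m2)
  · intro p hp
    obtain ⟨S', hS', hpS'⟩ := mem_iUnion₂.1 (hI.cover hp)
    by_cases h : S' = S
    · subst h
      obtain ⟨S'', hS'', hp''⟩ := Square.exists_mem_children hpS'
      exact mem_biUnion (Or.inr hS'' : S'' ∈ Square.split leaves S') hp''
    · exact mem_biUnion (Or.inl ⟨hS', h⟩ : S' ∈ Square.split leaves S) hpS'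
  · rintro S' (⟨hS', -⟩ | hS')
    · obtain ⟨S'', hc, p, hp, l, hl, hpl⟩ := hI.parent S' hS'
      exact ⟨S'', hc, p, hp, l, mem_insert_of_mem _ hl, hpl⟩
    · exact ⟨S, hS', _, hqS, j, mem_insert _ _, hjb⟩
  · intro f hf
    rcases List.mem_cons.1 hf with rfl | hf
    · exact ⟨hw.1, le_rfl, by dsimp only; linarith⟩
    rcases List.mem_cons.1 hf with rfl | hf
    · exact ⟨hs0, hsn.trans htn, first.1.1.2⟩
    · exact hI.times f (List.mem_cons_of_mem _ hf)
  · refine List.isChain_cons_cons.2 ⟨T.sees_comm.1 hsee, ?_⟩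
    cases rest with
    | nil => exact List.IsChain.singleton _
    | cons g r => exact List.isChain_cons_cons.2 (List.isChain_cons_cons.1 hI.returns)
  · simp only [List.head?_cons, Option.some.injEq, forall_eq']
    rw [l2, (T.poly j).pos_add_n hw.1]
  · intro f hf x hx hSA
    replace hSA := hSA.of_split hS
    rcases List.mem_cons.1 hf with rfl | hf
    · exact absurd (hx.1.trans_lt hx.2) (lt_irrefl _)
    rcases List.mem_cons.1 hf with rfl | hf
    · rcases lt_or_ge x now with h | h
      · exact hI.tested_active _ List.mem_cons_self x ⟨hx.1, h⟩ hSA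
      · exact absurd (first.2 ⟨⟨h, hx.2.le.trans first.1.1.2⟩, hSA⟩) (not_le.2 hx.2)
    · exact hI.tested_active f (List.mem_cons_of_mem _ hf) x hx hSA
  · rintro l (rfl | hl)
    · exact Or.inl ⟨_, List.mem_cons_self, rfl⟩
    · rcases hI.tested l hl with ⟨f, hf, hfl⟩ | h
      · rcases List.mem_cons.1 hf with rfl | hf
        · exact Or.inl ⟨_, List.mem_cons_of_mem _ List.mem_cons_self, hfl⟩
        · exact Or.inl ⟨f, List.mem_cons_of_mem _ (List.mem_cons_of_mem _ hf), hfl⟩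
      · exact Or.inr fun p hp hSA => h p hp (hSA.of_split hS)
  · obtain ⟨μ, hμ, l, hl, hB⟩ := hI.budget
    obtain ⟨l', hl', hpot⟩ := exists_split_list hμ hl hS
    refine ⟨μ, hμ, l', hl', ?_⟩
    rw [reserve_insert _ hj] at hB
    rw [S.diam_eq (S.side_nonneg hqS)] at hdist
    have h2 := (T.poly j).arc_add_n hw.1
    -- The approaching segment is travelled twice, at a cost of at most `4 * S.diam`.
    have h3 : 2 * dist ((T.poly i).pos t) ((T.poly j).pos w) ≤ 4 * √2 * S.side := by linarith
    rw [e2, e1, dist_self, hpot]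
    cases rest <;> simp only [pending, dist_comm ((T.poly j).pos w)] at hB ⊢ <;> linarith

theorem ExploreInv.tested_of_nothing {B : ℝ} {path : List Plane} {leaves : Set Square}
    {known : Set (Option ι)} {f : Frame ι} {rest : List (Frame ι)}
    (hI : ExploreInv T B path leaves known (f :: rest))
    (nothing : ∀ x ∈ Icc f.now (f.start + (T.poly f.i).n),
      ¬ SomethingApproachable T leaves known ((T.poly f.i).pos x)) {l : Option ι} (hl : l ∈ known) :
    (∃ g ∈ rest, g.i = l) ∨
      ∀ p ∈ (T.poly l).bdry, ¬ SomethingApproachable T leaves known p := by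
  rcases hI.tested l hl with ⟨g, hg, hgl⟩ | h
  · rcases List.mem_cons.1 hg with rfl | hg
    · refine Or.inr fun p hp => ?_
      rw [← hgl, ← (T.poly g.i).image_pos_turn (hI.times g List.mem_cons_self).1] at hp
      obtain ⟨x, hx, rfl⟩ := hp
      rcases lt_or_ge x g.now with h | h
      · exact hI.tested_active g List.mem_cons_self x ⟨hx.1, h⟩
      · exact nothing x ⟨h, hx.2⟩
    · exact Or.inl ⟨g, hg, hgl⟩
  · exact Or.inr h

theorem ExploreInv.back {B : ℝ} {path : List Plane} {leaves : Set Square}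
    {known : Set (Option ι)} {i i' : Option ι} {s now s' now' : ℝ} {rest : List (Frame ι)}
    (hI : ExploreInv T B path leaves known (⟨i, s, now⟩ :: ⟨i', s', now'⟩ :: rest))
    (nothing : ∀ x ∈ Icc now (s + (T.poly i).n),
      ¬ SomethingApproachable T leaves known ((T.poly i).pos x)) :
    ExploreInv T B (path ++ (T.poly i).run now (s + (T.poly i).n) ++ [(T.poly i').pos now'])
      leaves known (⟨i', s', now'⟩ :: rest) := by
  obtain ⟨hs0, hsn, hnt⟩ := hI.times _ List.mem_cons_self
  dsimp only at hs0 hsn hnt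
  obtain ⟨l1, m1, c1, -, e1⟩ := append_run (hI.last _ rfl) hI.trace_subset i (hs0.trans hsn) hnt
    (sees_pos_self i (hs0.trans hsn))
  rw [(T.poly i).pos_add_n hs0] at l1
  have hsee : T.Sees ((T.poly i).pos s) ((T.poly i').pos now') :=
    (List.isChain_cons_cons.1 hI.returns).1
  have htr := polylineTrace_append (m := [(T.poly i').pos now']) l1 rfl
  have hlen := polylineLength_append (m := [(T.poly i').pos now']) l1 rfl
  refine ⟨?_, ?_, hI.known_nonempty, hI.cover, hI.parent,
    fun f hf => hI.times f (List.mem_cons_of_mem _ hf), (List.isChain_cons_cons.1 hI.returns).2, ?_,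
    fun f hf => hI.tested_active f (List.mem_cons_of_mem _ hf),
    fun l hl => hI.tested_of_nothing nothing hl, ?_⟩
  · rw [htr]
    exact union_subset (union_subset c1 hsee)
      (singleton_subset_iff.2 (hsee (right_mem_segment ℝ _ _)))
  · intro l hl
    rw [htr]
    exact ((hI.covered l hl).trans m1).trans (subset_union_left.trans subset_union_left)
  · rintro f hf
    obtain rfl := Option.some.inj hf
    exact getLast?_append_of rfl
  · obtain ⟨μ, hμ, l, hl, hB⟩ := hI.budget
    refine ⟨μ, hμ, l, hl, ?_⟩
    rw [hlen, e1, dist_self]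
    simp only [pending, polylineLength] at hB ⊢
    linarith

theorem ExploreInv.finish {B : ℝ} {path : List Plane} {leaves : Set Square}
    {known : Set (Option ι)} {i : Option ι} {s now : ℝ}
    (hI : ExploreInv T B path leaves known [⟨i, s, now⟩])
    (nothing : ∀ x ∈ Icc now (s + (T.poly i).n),
      ¬ SomethingApproachable T leaves known ((T.poly i).pos x)) :
    ExploreInv T B (path ++ (T.poly i).run now (s + (T.poly i).n)) leaves known [] := by
  obtain ⟨hs0, hsn, hnt⟩ := hI.times _ List.mem_cons_self
  dsimp only at hs0 hsn hnt
  obtain ⟨-, m1, c1, -, e1⟩ := append_run (hI.last _ rfl) hI.trace_subset i (hs0.trans hsn) hnt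
    (sees_pos_self i (hs0.trans hsn))
  refine ⟨c1, fun l hl => (hI.covered l hl).trans m1, hI.known_nonempty, hI.cover, hI.parent,
    by simp, List.IsChain.nil, by simp, by simp, fun l hl => hI.tested_of_nothing nothing hl, ?_⟩
  obtain ⟨μ, hμ, l, hl, hB⟩ := hI.budget
  refine ⟨μ, hμ, l, hl, ?_⟩
  rw [e1, dist_self]
  simp only [pending] at hB ⊢
  linarith

/-- When the outermost call has been completed, the procedure has been called on all polygons. -/
theorem ExploreInv.known_eq_univ {B : ℝ} {path : List Plane} {leaves : Set Square}
    {known : Set (Option ι)} (hI : ExploreInv T B path leaves known []) : known = univ := by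
  by_contra hu
  obtain ⟨i, hi, p, hp, hSA⟩ := exists_approachable hI.known_nonempty hu hI.cover hI.parent
  rcases hI.tested i hi with ⟨f, hf, -⟩ | h
  · simp at hf
  · exact h p hp hSA

theorem ExploreInv.explored {B : ℝ} {path : List Plane} {leaves : Set Square}
    {known : Set (Option ι)} (hI : ExploreInv T B path leaves known []) :
    T.carrier ⊆ T.explored (polylineTrace path) := by
  intro p hp
  obtain ⟨i, q, hq, hsee⟩ := exists_sees_bdry T hp
  exact ⟨q, hI.covered i (hI.known_eq_univ ▸ mem_univ i) hq, T.sees_comm.1 hsee⟩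

theorem ExploreInv.length_le {B : ℝ} {path : List Plane} {leaves : Set Square}
    {known : Set (Option ι)} (hI : ExploreInv T B path leaves known []) :
    polylineLength path ≤ B := by
  obtain ⟨μ, hμ, l, -, hB⟩ := hI.budget
  have h1 := reserve_nonneg (T := T) (c := 4 * √2 * (3 * μ / 2)) (by positivity) known
  have h2 : 0 ≤ 4 * √2 * listPotential μ l := mul_nonneg (by positivity) (listPotential_nonneg hμ l)
  simp only [pending] at hB
  linarith

/-! ### Executions -/

/-- What holds in every state of an execution. -/
def Inv (T : Terrain ι) (v d : Plane) : State ι → Prop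
  | .walk path τ => WalkInv T v d path τ
  | .explore path leaves known stack =>
    ExploreInv T (5 * T.perimeter + 12 * T.hullDiam * √(Fintype.card ι)) path leaves known stack

theorem Inv.step {v d : Plane} (hv : v ∈ T.carrier) {c c' : State ι} (hI : Inv T v d c)
    (h : Step T v d c c') : Inv T v d c' := by
  cases h with
  | progress round free =>
    obtain ⟨h0, hb, -, -, hl, htr, V, hV, hV'⟩ := WalkInv.round hI round
    exact ⟨h0, T.bdry_subset_carrier _ hb, hl, htr, V, hV, hV', fun _ => free⟩
  | start round blocked smallest => exact ExploreInv.start hv hI round blocked smallest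
  | approach first hw app => exact ExploreInv.approach hI first hw app
  | back nothing => exact ExploreInv.back hI nothing
  | finish nothing => exact ExploreInv.finish hI nothing

theorem Inv.exists_step {v d : Plane} (hd : d ≠ 0) {c : State ι} (hI : Inv T v d c)
    (hc : ¬ c.Finished) : ∃ c', Step T v d c c' := by
  cases c with
  | walk path τ =>
    obtain ⟨i, t, τu, path', h⟩ := WalkInv.exists_round hd hI
    by_cases hp : CanProgress T v d τu
    · exact ⟨_, .progress h hp⟩
    · obtain ⟨S, hS, -⟩ := (T.poly i).exists_isSmallest
      exact ⟨_, .start h hp hS⟩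
  | explore path leaves known stack =>
    cases stack with
    | nil => exact (hc rfl).elim
    | cons f rest =>
      obtain ⟨i, s, now⟩ := f
      obtain ⟨hs0, hsn, -⟩ := ExploreInv.times hI _ List.mem_cons_self
      by_cases h : ∃ x ∈ Icc now (s + (T.poly i).n),
          SomethingApproachable T leaves known ((T.poly i).pos x)
      · obtain ⟨t, ht⟩ := exists_first_approachable (ExploreInv.leaves_finite hI) known (T.poly i)
          (hs0.trans hsn) h
        obtain ⟨S, j, q, hA⟩ := ht.1.2
        obtain ⟨w, hw, rfl⟩ := (T.poly j).exists_pos_eq hA.2.2.1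
        exact ⟨_, .approach ht hw hA⟩
      · push Not at h
        cases rest with
        | nil => exact ⟨_, .finish h⟩
        | cons g rest =>
          obtain ⟨i', s', now'⟩ := g
          exact ⟨_, .back h⟩

/-- The number of polygons that the half-line meets beyond the parameter `τ`. -/
noncomputable def ahead (T : Terrain ι) (v d : Plane) (τ : ℝ) : ℕ :=
  {i | ∃ x, τ < x ∧ ray v d x ∈ (T.poly i).region}.ncard

open Classical in
/-- A bound for the number of remaining steps. In the walk, the second summand accounts for a first
round that does not advance on the half-line, as happens when the starting point is the last point
of a polygon. -/
noncomputable def stepBound (T : Terrain ι) (v d : Plane) : State ι → ℕ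
  | .walk _ τ => 2 * ahead T v d τ + (if CanProgress T v d τ then 0 else 1) +
      (2 * Fintype.card (Option ι) + 2)
  | .explore _ _ known stack => 2 * knownᶜ.ncard + stack.length

theorem ahead_le {v d : Plane} {τ τu : ℝ} (h : τ ≤ τu) : ahead T v d τu ≤ ahead T v d τ :=
  ncard_le_ncard (fun _ ⟨x, hx, hr⟩ => ⟨x, h.trans_lt hx, hr⟩) (toFinite _)

theorem WalkRound.ahead_lt {v d : Plane} {path path' : List Plane} {τ τu t : ℝ} {i : Option ι}
    (h : WalkRound T v d path τ i t τu path') (hlt : τ < τu) :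
    ahead T v d τu < ahead T v d τ := by
  obtain ⟨_, _, _, _, _, hτu, _⟩ := h
  refine ncard_lt_ncard ⟨fun _ ⟨x, hx, hr⟩ => ⟨x, hlt.trans hx, hr⟩, fun hsub => ?_⟩ (toFinite _)
  obtain ⟨x, hx, hr⟩ := hsub (show i ∈ _ from ⟨τu, hlt, hτu.1.2⟩)
  exact absurd (hτu.2 ⟨hτu.1.1.trans hx.le, hr⟩) (not_le.2 hx)

theorem Inv.stepBound_lt {v d : Plane} {c c' : State ι} (hI : Inv T v d c)
    (h : Step T v d c c') : stepBound T v d c' < stepBound T v d c := by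
  cases h with
  | @progress path path' τ τu t i round free =>
    obtain ⟨hle, hlt⟩ := round.le (WalkInv.nonneg hI)
    simp only [stepBound, if_pos free]
    split_ifs with hp
    · have := round.ahead_lt (hlt hp)
      omega
    · have := ahead_le (T := T) (v := v) (d := d) hle
      omega
  | @start path path' τ τu t i S round blocked smallest =>
    have : ({i}ᶜ : Set (Option ι)).ncard ≤ Fintype.card (Option ι) := by
      rw [← Nat.card_eq_fintype_card, ← ncard_univ]
      exact ncard_le_ncard (subset_univ _) (toFinite _)
    simp only [stepBound, List.length_singleton]
    omega
  | @approach path leaves known i j s now t w rest S first hw app =>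
    have : (insert j known)ᶜ.ncard < knownᶜ.ncard :=
      ncard_lt_ncard (compl_lt_compl_iff_lt.2 (ssubset_insert app.2.1)) (toFinite _)
    simp only [stepBound, List.length_cons]
    omega
  | back nothing => simp [stepBound]
  | finish nothing => simp [stepBound]

end TerrainExploration

open TerrainExploration in
theorem theorem2p1 {ι : Type*} [Fintype ι] (T : Terrain ι)
    (v : Plane) (hv : v ∈ T.carrier) (d : Plane) (hd : d ≠ 0) :
    -- the algorithm has no infinite execution
    (¬ ∃ e : ℕ → State ι, e 0 = State.init v ∧ ∀ m, Step T v d (e m) (e (m + 1))) ∧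
    -- whenever it stops, it has been completed, and the trajectory is as claimed
    (∀ c : State ι, Relation.ReflTransGen (Step T v d) (State.init v) c →
      (¬ ∃ c', Step T v d c c') →
        c.Finished ∧
        polylineTrace c.path ⊆ T.carrier ∧
        T.carrier ⊆ T.explored (polylineTrace c.path) ∧
        polylineLength c.path
          ≤ 5 * T.perimeter + 12 * T.hullDiam * Real.sqrt (Fintype.card ι)) := by
  have hinit : Inv T v d (State.init v) := WalkInv.init hv
  constructor
  · rintro ⟨e, h0, hstep⟩
    have hI : ∀ m, Inv T v d (e m) := fun m => by
      induction m with
      | zero => rw [h0]; exact hinit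
      | succ m ih => exact ih.step hv (hstep m)
    exact not_strictAnti_of_wellFoundedLT (fun m => stepBound T v d (e m))
      (strictAnti_nat_of_succ_lt fun m => (hI m).stepBound_lt (hstep m))
  · intro c hc hstuck
    have hI : Inv T v d c := by
      clear hstuck
      induction hc with
      | refl => exact hinit
      | tail _ hs ih => exact ih.step hv hs
    have hfin : c.Finished := by
      by_contra h
      exact hstuck (hI.exists_step hd h)
    cases c with
    | walk path τ => exact hfin.elim
    | explore path leaves known stack =>
      obtain rfl : stack = [] := hfin
      exact ⟨rfl, ExploreInv.trace_subset hI, ExploreInv.explored hI, ExploreInv.length_le hI⟩
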